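/- Consider a ring of $N$ processes, each holding at most one token. In Herman's protocol, in each synchronous time step every process that holds a token independently either keeps it or passes it to its clockwise neighbour, each with probability $1/2$; whenever a process then has two tokens (one kept, one received), both are annihilated. For an initial configuration $z$, let the stabilization time $T_z$ be the smallest $t \ge 0$ such that exactly one token is left after $t$ steps. Then for every $N$ and every configuration $z$ with an odd number of tokens on the ring of $N$ processes, $$\mathbb{E}\,T_z \le \frac{4}{27} N^2 .$$ Moreover, the constant is optimal: if $h \ge 0$ is a real number such that $\mathbb{E}\,T_z \le h N^2$ for all $N \ge 3$ and all configurations $z$ with an odd number of tokens on the ring of $N$ processes, then $h \ge \frac{4}{27}$. -/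

import Mathlib

open MeasureTheory
open scoped NNReal ENNReal symmDiff

namespace Herman

/-- A configuration on a ring of `N` processes: the set of processes holding a token. The processes
are numbered clockwise by `Fin N`, so that `finRotate N i` is the clockwise neighbour of `i`. -/
abbrev Config (N : ℕ) : Type := Finset (Fin N)

/-- One synchronous coin flip per process: `c i = true` means that process `i`, if it holds a
token, passes it to its clockwise neighbour, and `c i = false` means that it keeps it. -/
abbrev Flips (N : ℕ) : Type := Fin N → Bool

/-- One step of the protocol. A process holds a token afterwards iff exactly one of the following
happens: it keeps its token, or it receives one; if both happen, both tokens are annihilated. -/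
def step {N : ℕ} (z : Config N) (c : Flips N) : Config N :=
  (z.filter fun i => c i = false) ∆ ((z.filter fun i => c i = true).map (finRotate N).toEmbedding)

/-- The configuration at time `t`, started from `z`, where `ω s` are the flips of the step from
time `s` to time `s + 1`. -/
def run {N : ℕ} (z : Config N) (ω : ℕ → Flips N) : ℕ → Config N
  | 0 => z
  | t + 1 => step (run z ω t) (ω t)

/-- The stabilization time: the first time at which exactly one token is left
(`⊤` if there is no such time). -/
noncomputable def stabTime {N : ℕ} (z : Config N) (ω : ℕ → Flips N) : ℕ∞ :=
  sInf {s : ℕ∞ | ∃ t : ℕ, s = t ∧ (run z ω t).card = 1}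

/-- The law of the flips: independent over time, and in each step uniform on `Fin N → Bool`,
that is, one independent fair coin per process. -/
noncomputable def flipMeasure (N : ℕ) : Measure (ℕ → Flips N) :=
  Measure.infinitePi fun _ : ℕ => (PMF.uniformOfFintype (Flips N)).toMeasure

/-- The expected stabilization time started from `z`, as a value in `[0, ∞]`. -/
noncomputable def expStabTime {N : ℕ} (z : Config N) : ℝ≥0∞ :=
  ∫⁻ ω, (stabTime z ω : ℝ≥0∞) ∂(flipMeasure N)

end Herman

/-! Scale the cyclic gaps between tokens to total length one. The Lyapunov function is `4 N² (c₃ -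
24 c₅)`, with `c₃`, `c₅` the cubic and quintic coefficients of the cyclic continuant, i.e. of the
trace of the product of the gap matrices.

Drift: written process by process, the trace is a product of edge and token matrices. Two tokens at
one process multiply to the identity, so annihilation is automatic. The product is multilinear in
the independent coins, so averaging over one step acts factor by factor and only changes the token
weight from `1` to `1 - X²/(4N²)` (`sum_ringTrace_step`). Comparing coefficients and using `24 c₃ ≤
1` (`cubicSum_le`), the Lyapunov function falls by at least one per step on average
(`sum_lyapunov_step_le`), hence bounds the expected time (`sum_survival_le`).

Size: it remains to show `c₃ - 24 c₅ ≤ 1/27` (`potential_le`). Shift length between the two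
neighbours of a gap, keeping their sum. If the potential is convex along this motion, one neighbour
may be shrunk to zero, which removes two gaps. If this fails everywhere and there are at least seven
gaps, an identity expressing `c₃` by cubes of alternating sums (`cubicSum_eq`) gives `c₃ ≤ 1/27`;
five gaps need a direct estimate (`quintuple_le`), and three are AM-GM.

Optimality: three tokens on three processes attain the bound. -/

namespace Herman

/-! ### Cyclic continuants and the potential of a list of gaps. -/

section Continuants

open Polynomial Matrix

/-- The transfer matrix of a gap of length `g`; the weight `t` is attached to the token at its
end. -/
noncomputable def gapMatrix (t : ℝ[X]) (g : ℝ) : Matrix (Fin 2) (Fin 2) ℝ[X] :=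
  !![C g * X, t; 1, 0]

/-- The product of the transfer matrices along a list of gaps. -/
noncomputable def transfer (t : ℝ[X]) (l : List ℝ) : Matrix (Fin 2) (Fin 2) ℝ[X] :=
  (l.map (gapMatrix t)).prod

/-- The cubic cyclic continuant coefficient: the sum of `g i * g j * g k` over all triples of gaps
that are cyclically separated by odd numbers of tokens. -/
noncomputable def cubicSum (l : List ℝ) : ℝ := (trace (transfer 1 l)).coeff 3

/-- The quintic cyclic continuant coefficient. -/
noncomputable def quinticSum (l : List ℝ) : ℝ := (trace (transfer 1 l)).coeff 5

/-- The normalized potential of a cyclic list of gaps. -/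
noncomputable def potential (l : List ℝ) : ℝ := cubicSum l - 24 * quinticSum l

@[simp] lemma transfer_nil (t : ℝ[X]) : transfer t [] = 1 := rfl

lemma transfer_cons (t : ℝ[X]) (g : ℝ) (l : List ℝ) :
    transfer t (g :: l) = gapMatrix t g * transfer t l := by simp [transfer]

lemma transfer_append (t : ℝ[X]) (l l' : List ℝ) :
    transfer t (l ++ l') = transfer t l * transfer t l' := by simp [transfer]

lemma transfer_cons_zero (t : ℝ[X]) (g : ℝ) (l : List ℝ) (j : Fin 2) :
    transfer t (g :: l) 0 j = C g * X * transfer t l 0 j + t * transfer t l 1 j := by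
  simp [transfer_cons, gapMatrix, Matrix.mul_apply, Fin.sum_univ_two]

lemma transfer_cons_one (t : ℝ[X]) (g : ℝ) (l : List ℝ) (j : Fin 2) :
    transfer t (g :: l) 1 j = transfer t l 0 j := by
  simp [transfer_cons, gapMatrix, Matrix.mul_apply, Fin.sum_univ_two]

lemma transfer_concat_one (g : ℝ) (l : List ℝ) (i : Fin 2) :
    transfer 1 (l ++ [g]) i 1 = transfer 1 l i 0 := by
  simp [transfer_append, transfer_cons, gapMatrix, Matrix.mul_apply, Fin.sum_univ_two]

lemma trace_transfer_append_comm (t : ℝ[X]) (l l' : List ℝ) :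
    trace (transfer t (l ++ l')) = trace (transfer t (l' ++ l)) := by
  rw [transfer_append, transfer_append, Matrix.trace_mul_comm]

lemma trace_transfer_rotate (t : ℝ[X]) (l : List ℝ) (n : ℕ) :
    trace (transfer t (l.rotate n)) = trace (transfer t l) := by
  rw [List.rotate_eq_drop_append_take_mod, trace_transfer_append_comm, List.take_append_drop]

lemma cubicSum_rotate (l : List ℝ) (n : ℕ) : cubicSum (l.rotate n) = cubicSum l := by
  simp [cubicSum, trace_transfer_rotate]

lemma potential_rotate (l : List ℝ) (n : ℕ) : potential (l.rotate n) = potential l := by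
  simp [potential, cubicSum, quinticSum, trace_transfer_rotate]

lemma potential_append_comm (l l' : List ℝ) : potential (l ++ l') = potential (l' ++ l) := by
  simp [potential, cubicSum, quinticSum, trace_transfer_append_comm 1 l l']

/-- A gap of length zero means two tokens at the same place; they cancel, and the outer gaps fuse.
-/
lemma potential_merge (a b : ℝ) (l : List ℝ) :
    potential (a :: 0 :: b :: l) = potential ((a + b) :: l) := by
  have h : gapMatrix 1 a * (gapMatrix 1 0 * gapMatrix 1 b) = gapMatrix 1 (a + b) := by
    ext i j
    fin_cases i <;> fin_cases j <;>
      simp [gapMatrix, Matrix.mul_apply, Fin.sum_univ_two, add_mul]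
  have h' : transfer 1 (a :: 0 :: b :: l) = transfer 1 ((a + b) :: l) := by
    simp only [transfer_cons, ← h, Matrix.mul_assoc]
  simp only [potential, cubicSum, quinticSum, h']

/-- The sum of the entries at the positions `0, 2, 4, …`. -/
def evenSum : List ℝ → ℝ
  | [] => 0
  | [a] => a
  | a :: _ :: l => a + evenSum l

/-- The sum of the entries at the positions `1, 3, 5, …`. -/
def oddSum (l : List ℝ) : ℝ := l.sum - evenSum l

lemma evenSum_cons (a : ℝ) (l : List ℝ) : evenSum (a :: l) = a + oddSum l := by
  induction l using List.twoStepInduction generalizing a with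
  | nil => simp [evenSum, oddSum]
  | singleton b => simp [evenSum, oddSum]
  | cons_cons b c l ih _ =>
    have := ih c
    simp only [evenSum, oddSum, List.sum_cons] at this ⊢
    linarith

lemma oddSum_cons (a : ℝ) (l : List ℝ) : oddSum (a :: l) = evenSum l := by
  have := evenSum_cons a l
  simp only [oddSum, List.sum_cons] at this ⊢
  linarith

lemma coeff_transfer_low (l : List ℝ) :
    (Even l.length → ((transfer 1 l 0 0).coeff 0 = 1 ∧ (transfer 1 l 1 1).coeff 0 = 1 ∧
      (transfer 1 l 0 1).coeff 0 = 0 ∧ (transfer 1 l 1 0).coeff 0 = 0 ∧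
      (transfer 1 l 0 1).coeff 1 = evenSum l ∧ (transfer 1 l 1 0).coeff 1 = oddSum l ∧
      (transfer 1 l 0 0).coeff 1 = 0 ∧ (transfer 1 l 1 1).coeff 1 = 0)) ∧
    (Odd l.length → ((transfer 1 l 0 1).coeff 0 = 1 ∧ (transfer 1 l 1 0).coeff 0 = 1 ∧
      (transfer 1 l 0 0).coeff 0 = 0 ∧ (transfer 1 l 1 1).coeff 0 = 0 ∧
      (transfer 1 l 0 0).coeff 1 = evenSum l ∧ (transfer 1 l 1 1).coeff 1 = oddSum l ∧
      (transfer 1 l 0 1).coeff 1 = 0 ∧ (transfer 1 l 1 0).coeff 1 = 0)) := by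
  induction l with
  | nil => simp [evenSum, oddSum, coeff_one]
  | cons a l ih =>
    have key : ∀ j : Fin 2, (transfer 1 (a :: l) 0 j).coeff 1 =
        a * (transfer 1 l 0 j).coeff 0 + (transfer 1 l 1 j).coeff 1 := by
      intro j
      rw [transfer_cons_zero, one_mul, coeff_add, mul_assoc, coeff_C_mul, coeff_X_mul]
    have key0 : ∀ j : Fin 2, (transfer 1 (a :: l) 0 j).coeff 0 =
        (transfer 1 l 1 j).coeff 0 := by
      intro j
      rw [transfer_cons_zero, one_mul, coeff_add, mul_assoc, coeff_C_mul, coeff_X_mul_zero]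
      simp
    rw [List.length_cons, evenSum_cons, oddSum_cons, key, key, key0, key0, transfer_cons_one,
      transfer_cons_one]
    constructor
    · intro h
      obtain ⟨h1, h2, h3, h4, h5, h6, h7, h8⟩ :=
        ih.2 (by rw [Nat.even_add_one, Nat.not_even_iff_odd] at h; exact h)
      simp [*]
    · intro h
      obtain ⟨h1, h2, h3, h4, h5, h6, h7, h8⟩ :=
        ih.1 (by rw [Nat.odd_add_one, Nat.not_odd_iff_even] at h; exact h)
      simp [*]

lemma coeff_trace_one {l : List ℝ} (h : Odd l.length) : (trace (transfer 1 l)).coeff 1 = l.sum := by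
  obtain ⟨-, -, -, -, h1, h2, -⟩ := (coeff_transfer_low l).2 h
  rw [Matrix.trace_fin_two, coeff_add, h1, h2, oddSum]; ring

/-- The quadratic coefficient of the upper left entry: the sum of `l i * l j` over `i < j` with
`i` even and `j` odd. -/
noncomputable def pairSum (l : List ℝ) : ℝ := (transfer 1 l 0 0).coeff 2

lemma det_transfer (l : List ℝ) : (transfer 1 l).det = (-1) ^ l.length := by
  induction l with
  | nil => simp
  | cons a l ih =>
    rw [transfer_cons, Matrix.det_mul, ih, gapMatrix, Matrix.det_fin_two_of, List.length_cons]
    ring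

lemma coeff_two_mul (p q : ℝ[X]) :
    (p * q).coeff 2 = p.coeff 0 * q.coeff 2 + p.coeff 1 * q.coeff 1 + p.coeff 2 * q.coeff 0 := by
  rw [coeff_mul, Finset.Nat.sum_antidiagonal_eq_sum_range_succ (fun i j => p.coeff i * q.coeff j)]
  simp [Finset.sum_range_succ]

/-- This is the quadratic coefficient of `det = -1` for the whole list, whose off-diagonal entries
are the upper left entries of the two shortened lists. -/
lemma pairSum_add_pairSum (a b : ℝ) (l : List ℝ) (h : Odd l.length) :
    pairSum (a :: l) + pairSum (l ++ [b]) =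
      evenSum (a :: l ++ [b]) * oddSum (a :: l ++ [b]) := by
  have hL : Odd (a :: l ++ [b]).length := by
    simp only [List.cons_append, List.length_cons, List.length_append, List.length_nil]
    grind
  have hdet := det_transfer (a :: l ++ [b])
  rw [hL.neg_one_pow, Matrix.det_fin_two] at hdet
  obtain ⟨h1, h2, h3, h4, h5, h6, h7, h8⟩ := (coeff_transfer_low _).2 hL
  have e1 : transfer 1 (a :: l ++ [b]) 0 1 = transfer 1 (a :: l) 0 0 := transfer_concat_one _ _ _
  have e2 : transfer 1 (a :: l ++ [b]) 1 0 = transfer 1 (l ++ [b]) 0 0 := transfer_cons_one _ _ _ _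
  have := congrArg (fun p => coeff p 2) hdet
  have hone : (-1 : ℝ[X]).coeff 2 = 0 := by simp [coeff_one]
  simp only [coeff_sub, coeff_two_mul, h1, h2, h3, h4, h5, h6, h7, h8, hone] at this
  rw [pairSum, pairSum, ← e1, ← e2]
  linarith

lemma trace_cons_cons_cons (a u b : ℝ) (r : List ℝ) :
    trace (transfer 1 (a :: u :: b :: r)) =
      C (a * u * b) * (X ^ 3 * transfer 1 r 0 0) + C (a + b) * (X ^ 1 * transfer 1 r 0 0) +
      C (a * u) * (X ^ 2 * transfer 1 r 1 0) + transfer 1 r 1 0 +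
      C (u * b) * (X ^ 2 * transfer 1 r 0 1) + transfer 1 r 0 1 +
      C u * (X ^ 1 * transfer 1 r 1 1) := by
  simp only [Matrix.trace_fin_two, transfer_cons, gapMatrix, Matrix.mul_apply, Fin.sum_univ_two]
  simp
  ring

/-- A continuant term omits gaps in adjacent pairs, so a term containing both `a` and `b` must
contain `u`; the remaining factor comes from the upper left entry of `r`. -/
lemma potential_cons_cons_cons (u : ℝ) {r : List ℝ} (h : Even r.length) :
    ∃ α β γ : ℝ, ∀ a b, potential (a :: u :: b :: r) =
      a * b * (u * (1 - 24 * pairSum r)) + α * a + β * b + γ := by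
  have h0 := ((coeff_transfer_low r).1 h).1
  refine ⟨pairSum r + u * (transfer 1 r 1 0).coeff 1 -
      24 * ((transfer 1 r 0 0).coeff 4 + u * (transfer 1 r 1 0).coeff 3),
    pairSum r + u * (transfer 1 r 0 1).coeff 1 -
      24 * ((transfer 1 r 0 0).coeff 4 + u * (transfer 1 r 0 1).coeff 3),
    (transfer 1 r 1 0).coeff 3 + (transfer 1 r 0 1).coeff 3 + u * (transfer 1 r 1 1).coeff 2 -
    24 * ((transfer 1 r 1 0).coeff 5 + (transfer 1 r 0 1).coeff 5 + u * (transfer 1 r 1 1).coeff 4),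
    fun a b => ?_⟩
  rw [potential, cubicSum, quinticSum, trace_cons_cons_cons]
  simp only [coeff_add, coeff_C_mul, coeff_X_pow_mul', h0, pairSum]
  norm_num [h0]
  ring

/-- With `a + b` fixed, the hypothesis on `pairSum r` makes the potential convex in `a`, so its
maximum is at an endpoint. -/
lemma potential_le_max (a u b : ℝ) {r : List ℝ} (h : Even r.length) (ha : 0 ≤ a) (hu : 0 ≤ u)
    (hb : 0 ≤ b) (hr : 1 ≤ 24 * pairSum r) :
    potential (a :: u :: b :: r) ≤
      max (potential ((a + b) :: u :: 0 :: r)) (potential (0 :: u :: (a + b) :: r)) := by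
  obtain ⟨α, β, γ, H⟩ := potential_cons_cons_cons u h
  rw [H, H, H]
  have h1 : a * b * (u * (1 - 24 * pairSum r)) ≤ 0 :=
    mul_nonpos_of_nonneg_of_nonpos (by positivity)
      (mul_nonpos_of_nonneg_of_nonpos hu (by linarith))
  rcases le_total α β with h2 | h2
  · refine le_max_of_le_right ?_
    nlinarith
  · refine le_max_of_le_left ?_
    nlinarith

end Continuants

end Herman

namespace Herman

/-! ### The cubic coefficient in terms of cubes of alternating sums. -/

section CubicIdentity

open Polynomial Matrix

lemma sum_range_rotate {α β : Type*} [AddCommMonoid β] (φ : List α → β) (l : List α) :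
    ∑ i ∈ Finset.range l.length, φ (l.rotate (i + 1)) =
      ∑ i ∈ Finset.range l.length, φ (l.rotate i) := by
  cases l with
  | nil => simp
  | cons a l =>
    rw [List.length_cons, Finset.sum_range_succ, Finset.sum_range_succ']
    congr 2
    rw [← List.length_cons (a := a), List.rotate_length, List.rotate_zero]

lemma sum_range_rotate_add {α β : Type*} [AddCommMonoid β] (φ : List α → β) (l : List α) (k : ℕ) :
    ∑ i ∈ Finset.range l.length, φ (l.rotate (i + k)) =
      ∑ i ∈ Finset.range l.length, φ (l.rotate i) := by
  induction k with
  | zero => rfl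
  | succ k ih =>
    rw [← ih]
    have := sum_range_rotate (fun m => φ (m.rotate k)) l
    simpa only [List.rotate_rotate, add_assoc, add_comm 1] using this

/-- The alternating sum of a list of gaps; up to sign, twice the height of the zigzag path at the
token before the first gap. -/
noncomputable def altSum (l : List ℝ) : ℝ := evenSum l - oddSum l

lemma altSum_cons (a : ℝ) (l : List ℝ) : altSum (a :: l) = a - altSum l := by
  rw [altSum, altSum, evenSum_cons, oddSum_cons]; ring

lemma altSum_append (l l' : List ℝ) :
    altSum (l ++ l') = altSum l + (-1) ^ l.length * altSum l' := by
  induction l with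
  | nil => simp [altSum, evenSum, oddSum]
  | cons a l ih => rw [List.cons_append, altSum_cons, altSum_cons, ih, List.length_cons]; ring

lemma altSum_singleton (a : ℝ) : altSum [a] = a := by simp [altSum, evenSum, oddSum]

lemma evenSum_mul_oddSum (l : List ℝ) :
    4 * (evenSum l * oddSum l) = l.sum ^ 2 - altSum l ^ 2 := by
  rw [altSum, oddSum]; ring

lemma altSum_add_altSum_rotate (a : ℝ) {l : List ℝ} (h : Even l.length) :
    altSum (a :: l) + altSum ((a :: l).rotate 1) = 2 * a := by
  rw [List.rotate_cons_succ, List.rotate_zero, altSum_cons, altSum_append, altSum_singleton,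
    h.neg_one_pow]
  ring

lemma altSum_add_altSum_rotate_succ {l : List ℝ} (h : Odd l.length) (i : ℕ) :
    altSum (l.rotate i) + altSum (l.rotate (i + 1)) = 2 * (l.rotate i).headD 0 := by
  rw [← List.rotate_rotate l i 1]
  have h' : (l.rotate i).length = l.length := List.length_rotate _ _
  rcases hl : l.rotate i with _ | ⟨a, m⟩
  · simp [hl] at h'; simp [← h'] at h
  · rw [altSum_add_altSum_rotate, List.headD_cons]
    rw [hl, List.length_cons] at h'
    rw [← h'] at h; grind

lemma sum_headD_rotate_append (l l' : List ℝ) :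
    ∑ i ∈ Finset.range l'.length, ((l ++ l').rotate (l.length + i)).headD 0 = l'.sum := by
  induction l' generalizing l with
  | nil => simp
  | cons a l' ih =>
    rw [List.length_cons, Finset.sum_range_succ', List.sum_cons, ← ih (l ++ [a])]
    simp [List.rotate_append_length_eq, add_comm, add_left_comm]

lemma sum_headD_rotate (l : List ℝ) :
    ∑ i ∈ Finset.range l.length, (l.rotate i).headD 0 = l.sum := by
  simpa using sum_headD_rotate_append [] l

lemma sum_altSum_rotate {l : List ℝ} (h : Odd l.length) :
    ∑ i ∈ Finset.range l.length, altSum (l.rotate i) = l.sum := by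
  have h1 := sum_range_rotate altSum l
  have h2 : ∑ i ∈ Finset.range l.length, (altSum (l.rotate i) + altSum (l.rotate (i + 1))) =
      2 * l.sum := by
    rw [← sum_headD_rotate, Finset.mul_sum]
    exact Finset.sum_congr rfl fun i _ => altSum_add_altSum_rotate_succ h i
  rw [Finset.sum_add_distrib, h1] at h2
  linarith

lemma map_derivative_mul (A B : Matrix (Fin 2) (Fin 2) ℝ[X]) :
    (A * B).map derivative = A.map derivative * B + A * B.map derivative := by
  ext i j : 2
  simp only [Matrix.map_apply, Matrix.mul_apply, Fin.sum_univ_two, Matrix.add_apply, derivative_add,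
    derivative_mul]
  ring_nf

/-- The product rule, with cyclicity of the trace bringing the differentiated factor to the front.
The prefix `l` holds the factors already passed; only `l = []` is needed later. -/
lemma trace_transfer_mul_derivative (l l' : List ℝ) :
    trace (transfer 1 l * (transfer 1 l').map derivative) =
      ∑ i ∈ Finset.range l'.length, C (((l ++ l').rotate (l.length + i)).headD 0) *
        transfer 1 ((l ++ l').rotate (l.length + i)).tail 0 0 := by
  induction l' generalizing l with
  | nil =>
    have : (1 : Matrix (Fin 2) (Fin 2) ℝ[X]).map derivative = 0 := by
      ext i j : 2
      fin_cases i <;> fin_cases j <;> simp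
    simp [this]
  | cons a l' ih =>
    rw [List.length_cons, Finset.sum_range_succ', add_zero, List.rotate_append_length_eq,
      List.cons_append, List.headD_cons, List.tail_cons, transfer_cons, map_derivative_mul,
      Matrix.mul_add, Matrix.trace_add, add_comm]
    congr 1
    · have := ih (l ++ [a])
      simp only [List.append_assoc, List.singleton_append, List.length_append,
        List.length_singleton] at this
      simp only [add_assoc, add_comm 1] at this
      rw [← this, transfer_append, transfer_cons, transfer_nil, Matrix.mul_one, Matrix.mul_assoc]
    · rw [← Matrix.mul_assoc, Matrix.trace_mul_comm, ← Matrix.mul_assoc, ← transfer_append]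
      simp [Matrix.trace_fin_two, Matrix.mul_apply, Fin.sum_univ_two, gapMatrix, Matrix.map_apply]
      ring

lemma three_mul_cubicSum (l : List ℝ) :
    3 * cubicSum l =
      ∑ i ∈ Finset.range l.length, (l.rotate i).headD 0 * pairSum (l.rotate i).tail := by
  have h := trace_transfer_mul_derivative [] l
  have h' : trace ((transfer 1 l).map derivative) = derivative (trace (transfer 1 l)) := by
    simp [Matrix.trace_fin_two]
  rw [transfer_nil, Matrix.one_mul, h'] at h
  have := congrArg (fun p => coeff p 2) h
  simp only [coeff_derivative, finsetSum_coeff, coeff_C_mul, List.nil_append, List.length_nil,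
    zero_add] at this
  rw [cubicSum]
  simp only [pairSum]
  rw [← this]
  norm_num
  ring

lemma pairSum_tail_add_pairSum_tail_rotate {l : List ℝ} (h : Odd l.length) (h3 : 3 ≤ l.length)
    (i : ℕ) : 4 * (pairSum (l.rotate i).tail + pairSum (l.rotate (i + 1)).tail) =
      l.sum ^ 2 - altSum (l.rotate (i + 1)) ^ 2 := by
  have hs : (l.rotate (i + 1)).sum = l.sum := (List.rotate_perm l _).sum_eq
  rw [← hs, ← evenSum_mul_oddSum, ← List.rotate_rotate l i 1]
  have h' : (l.rotate i).length = l.length := List.length_rotate _ _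
  rcases hl : l.rotate i with _ | ⟨b, _ | ⟨a, m⟩⟩
  · simp [hl] at h'; omega
  · simp [hl] at h'; omega
  · rw [List.rotate_cons_succ, List.rotate_zero, List.tail_cons, List.cons_append, List.tail_cons,
      pairSum_add_pairSum, List.cons_append]
    rw [hl, List.length_cons, List.length_cons] at h'
    rw [← h'] at h; grind

/-- Write `A i` for the alternating sum from gap `i`, and `P i` for `pairSum` of the other gaps.
Then `2 g i = A i + A (i+1)` and `4 (P i + P (i+1)) = S² - A (i+1)²`. Substituting both into `3 c₃ =
∑ g i * P i`, the terms `A i * P i` cancel cyclically. -/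
lemma cubicSum_eq {l : List ℝ} (h : Odd l.length) (h3 : 3 ≤ l.length) :
    24 * cubicSum l =
      l.sum ^ 3 - ∑ i ∈ Finset.range l.length, altSum (l.rotate i) ^ 3 := by
  have h1 := three_mul_cubicSum l
  have h2 : ∀ i ∈ Finset.range l.length,
      8 * ((l.rotate i).headD 0 * pairSum (l.rotate i).tail) =
        4 * (altSum (l.rotate i) * pairSum (l.rotate i).tail) +
        (altSum (l.rotate (i + 1)) * (l.sum ^ 2 - altSum (l.rotate (i + 1)) ^ 2) -
        4 * (altSum (l.rotate (i + 1)) * pairSum (l.rotate (i + 1)).tail)) := by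
    intro i _
    have e1 := altSum_add_altSum_rotate_succ h i
    rw [← pairSum_tail_add_pairSum_tail_rotate h h3 i]
    linear_combination (-4 * pairSum (l.rotate i).tail) * e1
  have h4 := Finset.sum_congr rfl h2
  rw [← Finset.mul_sum, Finset.sum_add_distrib, Finset.sum_sub_distrib,
    sum_range_rotate (fun m => altSum m * (l.sum ^ 2 - altSum m ^ 2)),
    ← Finset.mul_sum, ← Finset.mul_sum, sum_range_rotate (fun m => altSum m * pairSum m.tail),
    ← h1] at h4
  have h5 : ∑ i ∈ Finset.range l.length, altSum (l.rotate i) * (l.sum ^ 2 - altSum (l.rotate i) ^ 2)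
      = l.sum ^ 3 - ∑ i ∈ Finset.range l.length, altSum (l.rotate i) ^ 3 := by
    rw [show l.sum ^ 3 = l.sum ^ 2 * ∑ i ∈ Finset.range l.length, altSum (l.rotate i) by
      rw [sum_altSum_rotate h]; ring, Finset.mul_sum, ← Finset.sum_sub_distrib]
    exact Finset.sum_congr rfl fun i _ => by ring
  rw [h5] at h4
  linarith

lemma add_cube_nonneg {x y : ℝ} (h : 0 ≤ x + y) : 0 ≤ x ^ 3 + y ^ 3 := by
  have : x ^ 3 + y ^ 3 = (x + y) * ((x - y) ^ 2 + (x ^ 2 + y ^ 2)) / 2 := by ring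
  rw [this]; positivity

lemma altSum_add_nonneg {l : List ℝ} (h : Odd l.length) (hl : ∀ x ∈ l, 0 ≤ x) (i : ℕ) :
    0 ≤ altSum (l.rotate i) + altSum (l.rotate (i + 1)) := by
  rw [altSum_add_altSum_rotate_succ h]
  rcases hm : l.rotate i with _ | ⟨a, m⟩
  · simp
  · have : a ∈ l.rotate i := by simp [hm]
    have := hl a (List.mem_rotate.1 this)
    simpa using this

/-- The other cubes are even in number and pair off consecutively; each pair is nonnegative, since
consecutive alternating sums add up to twice a gap. -/
lemma altSum_cube_le {l : List ℝ} (h : Odd l.length) (hl : ∀ x ∈ l, 0 ≤ x) :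
    altSum l ^ 3 ≤ ∑ i ∈ Finset.range l.length, altSum (l.rotate i) ^ 3 := by
  have key : ∀ m : ℕ, altSum l ^ 3 ≤ ∑ i ∈ Finset.range (2 * m + 1), altSum (l.rotate i) ^ 3 := by
    intro m
    induction m with
    | zero => simp
    | succ m ih =>
      rw [show 2 * (m + 1) + 1 = 2 * m + 1 + 1 + 1 by ring, Finset.sum_range_succ,
        Finset.sum_range_succ]
      have := add_cube_nonneg (altSum_add_nonneg h hl (2 * m + 1))
      linarith
  obtain ⟨m, hm⟩ := h
  rw [hm]; exact key m

lemma altSum_rotate_cube_le {l : List ℝ} (h : Odd l.length) (h3 : 3 ≤ l.length)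
    (hl : ∀ x ∈ l, 0 ≤ x) (i : ℕ) :
    altSum (l.rotate i) ^ 3 ≤ l.sum ^ 3 - 24 * cubicSum l := by
  have h1 : (l.rotate i).length = l.length := List.length_rotate _ _
  have h2 := altSum_cube_le (l := l.rotate i) (by rwa [h1])
    (fun x hx => hl x (List.mem_rotate.1 hx))
  have h4 := cubicSum_eq (l := l.rotate i) (by rwa [h1]) (by rwa [h1])
  rw [cubicSum_rotate, (List.rotate_perm l _).sum_eq] at h4
  linarith

/-- Two consecutive alternating sums have cubes with nonnegative sum, and each cube is at most `S³ -
24 c₃`. -/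
lemma cubicSum_le {l : List ℝ} (h : Odd l.length) (h3 : 3 ≤ l.length)
    (hl : ∀ x ∈ l, 0 ≤ x) : 24 * cubicSum l ≤ l.sum ^ 3 := by
  have h0 := altSum_rotate_cube_le h h3 hl 0
  have h1 := altSum_rotate_cube_le h h3 hl 1
  have := add_cube_nonneg (altSum_add_nonneg h hl 0)
  rw [zero_add] at this
  linarith

end CubicIdentity

end Herman

namespace Herman

/-! ### The sharp bound on the potential. -/

section PotentialBound

open Polynomial Matrix

lemma coeff_transfer_nonneg {l : List ℝ} (hl : ∀ x ∈ l, 0 ≤ x) (i j : Fin 2) (n : ℕ) :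
    0 ≤ (transfer 1 l i j).coeff n := by
  induction l generalizing i j n with
  | nil =>
    rw [transfer_nil, Matrix.one_apply]
    split_ifs
    · rw [coeff_one]; split_ifs <;> simp
    · simp
  | cons a l ih =>
    have ih := ih fun x hx => hl x (List.mem_cons_of_mem _ hx)
    have ha := hl a List.mem_cons_self
    match i with
    | 0 =>
      rw [transfer_cons_zero, one_mul, coeff_add, mul_assoc, coeff_C_mul]
      refine add_nonneg (mul_nonneg ha ?_) (ih _ _ _)
      cases n with
      | zero => simp
      | succ n => rw [coeff_X_mul]; exact ih _ _ _
    | 1 => rw [transfer_cons_one]; exact ih _ _ _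

lemma quinticSum_nonneg {l : List ℝ} (hl : ∀ x ∈ l, 0 ≤ x) : 0 ≤ quinticSum l := by
  rw [quinticSum, Matrix.trace_fin_two, coeff_add]
  exact add_nonneg (coeff_transfer_nonneg hl _ _ _) (coeff_transfer_nonneg hl _ _ _)

lemma potential_singleton (a : ℝ) : potential [a] = 0 := by
  simp [potential, cubicSum, quinticSum, Matrix.trace_fin_two, transfer_cons, gapMatrix]

lemma potential_triple (a b c : ℝ) : potential [a, b, c] = a * b * c := by
  rw [potential, cubicSum, quinticSum, trace_cons_cons_cons]
  simp only [transfer_nil, Matrix.one_apply_eq, coeff_add, coeff_C_mul, coeff_X_pow_mul', coeff_one]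
  simp

lemma pairSum_pair (a b : ℝ) : pairSum [a, b] = a * b := by
  simp only [pairSum, transfer_cons_zero, transfer_cons_one, transfer_nil, mul_assoc, coeff_add,
    coeff_C_mul, one_mul, coeff_X_mul, Matrix.one_apply_eq]
  simp [coeff_one]

lemma potential_quintuple (a b c d e : ℝ) : potential [a, b, c, d, e] =
    a * b * c + b * c * d + c * d * e + d * e * a + e * a * b - 24 * (a * b * c * d * e) := by
  have h00 : transfer 1 [d, e] 0 0 = C (d * e) * X ^ 2 + 1 := by
    simp only [transfer_cons_zero, transfer_cons_one, transfer_nil]; simp; ring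
  have h01 : transfer 1 [d, e] 0 1 = C d * X ^ 1 := by
    simp only [transfer_cons_zero, transfer_cons_one, transfer_nil]; simp
  have h10 : transfer 1 [d, e] 1 0 = C e * X ^ 1 := by
    simp only [transfer_cons_zero, transfer_cons_one, transfer_nil]; simp
  have h11 : transfer 1 [d, e] 1 1 = 1 := by
    simp only [transfer_cons_zero, transfer_cons_one, transfer_nil]; simp
  rw [potential, cubicSum, quinticSum, trace_cons_cons_cons, h00, h01, h10, h11]
  simp only [coeff_add, coeff_C_mul, coeff_X_pow_mul', coeff_one, coeff_X_pow]
  norm_num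
  ring

lemma prod_three_le {a b c : ℝ} (ha : 0 ≤ a) (hb : 0 ≤ b) (hc : 0 ≤ c) (h : a + b + c = 1) :
    a * b * c ≤ 1 / 27 := by
  obtain rfl : c = 1 - a - b := by linarith
  nlinarith [mul_nonneg ha (sq_nonneg (a - b)), mul_nonneg hb (sq_nonneg (a - b)),
    mul_nonneg ha (sq_nonneg (3 * a - 1)), mul_nonneg hb (sq_nonneg (3 * b - 1)),
    mul_nonneg hc (sq_nonneg (a - b)), mul_nonneg ha (sq_nonneg (b - (1 - a - b))),
    mul_nonneg hb (sq_nonneg (a - (1 - a - b))), sq_nonneg (a + b - 2 / 3), sq_nonneg (a - b)]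

lemma quintuple_cubic_le {a b c d e : ℝ} (ha : 0 ≤ a) (hb : 0 ≤ b) (hc : 0 ≤ c) (hd : 0 ≤ d)
    (he : 0 ≤ e) (h : a + b + c + d + e = 1) (hab : a * b ≤ 1 / 72) (hbc : b * c ≤ 1 / 24)
    (hcd : c * d ≤ 1 / 24) (hde : d * e ≤ 1 / 24) (hea : e * a ≤ 1 / 24) :
    a * b * c + b * c * d + c * d * e + d * e * a + e * a * b ≤ 1 / 27 := by
  have h1 := mul_le_mul_of_nonneg_left hab (add_nonneg hc he)
  -- Splitting `c * d * e` evenly between its two products gives the bound `(1 - (d + (c + e) / 6))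
  -- / 24`, which is at most `1/27` exactly in the first case. In the other case `d` and `c + e` are
  -- small.
  rcases le_total (1 / 9) (d + (c + e) / 6) with hd' | hd'
  · have h2 := mul_le_mul_of_nonneg_left hcd (add_nonneg hb (by positivity : 0 ≤ e / 2))
    have h3 := mul_le_mul_of_nonneg_left hde (add_nonneg ha (by positivity : 0 ≤ c / 2))
    nlinarith
  · have h2 : c * e ≤ 1 / 9 := by nlinarith [sq_nonneg (c - e)]
    have h3 : d * (b * c + c * e + e * a) ≤ d * (7 / 36) :=
      mul_le_mul_of_nonneg_left (by linarith) hd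
    nlinarith

lemma sq_sum_sub_one_le {x y z v w : ℝ} (hx : 0 ≤ x) (hy : 0 ≤ y) (hz : 0 ≤ z) (hv : 0 ≤ v)
    (hw : 0 ≤ w) (hx' : x ≤ 2) (hy' : y ≤ 2) (hz' : z ≤ 2) (hv' : v ≤ 2) (hw' : w ≤ 2) :
    (4 + (x + y + z + v + w)) ^ 2 ≤
      16 * ((1 + x) * (1 + y) * (1 + z) * (1 + v) * (1 + w)) := by
  have h1 : 0 ≤ x * (2 - x) + y * (2 - y) + z * (2 - z) + v * (2 - v) + w * (2 - w) := by
    have := sub_nonneg.2 hx'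
    have := sub_nonneg.2 hy'
    have := sub_nonneg.2 hz'
    have := sub_nonneg.2 hv'
    have := sub_nonneg.2 hw'
    positivity
  have h2 : 16 * ((1 + x) * (1 + y) * (1 + z) * (1 + v) * (1 + w)) -
      (4 + (x + y + z + v + w)) ^ 2 =
      (x * (2 - x) + y * (2 - y) + z * (2 - z) + v * (2 - v) + w * (2 - w)) +
      6 * (x + y + z + v + w) +
      14 * (x * y + x * z + x * v + x * w + y * z + y * v + y * w + z * v + z * w + v * w) +
      16 * (x * y * z + x * y * v + x * y * w + x * z * v + x * z * w + x * v * w +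
        y * z * v + y * z * w + y * v * w + z * v * w +
        x * y * z * v + x * y * z * w + x * y * v * w + x * z * v * w + y * z * v * w +
        x * y * z * v * w) := by ring
  have h3 : 0 ≤ 6 * (x + y + z + v + w) +
      14 * (x * y + x * z + x * v + x * w + y * z + y * v + y * w + z * v + z * w + v * w) +
      16 * (x * y * z + x * y * v + x * y * w + x * z * v + x * z * w + x * v * w +
        y * z * v + y * z * w + y * v * w + z * v * w +
        x * y * z * v + x * y * z * w + x * y * v * w + x * z * v * w + y * z * v * w +
        x * y * z * v * w) := by positivity
  linarith

lemma inv_sub_one_mem {q : ℝ} (h1 : 1 / 72 < q) (h2 : q ≤ 1 / 24) :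
    0 ≤ (24 * q)⁻¹ - 1 ∧ (24 * q)⁻¹ - 1 ≤ 2 := by
  have hq : 0 < 24 * q := by linarith
  constructor
  · have := (one_le_inv₀ hq).2 (by linarith)
    linarith
  · have := inv_anti₀ (by norm_num : (0 : ℝ) < 1 / 3) (by linarith : 1 / 3 ≤ 24 * q)
    norm_num at this ⊢
    linarith

/-- Put `P = abcde` and `x = 1/(24 q) - 1 ∈ [0, 2]` for each adjacent product `q`. The left side is
`24 P (4 + ∑ x)`, and `P² ∏ (1 + x)` is constant, so `sq_sum_sub_one_le` bounds its square by `1/864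
< 1/27²`. -/
lemma quintuple_le_of_large {a b c d e : ℝ} (ha : 0 < a) (hb : 0 < b) (hc : 0 < c) (hd : 0 < d)
    (he : 0 < e) (hab : a * b ≤ 1 / 24) (hbc : b * c ≤ 1 / 24)
    (hcd : c * d ≤ 1 / 24) (hde : d * e ≤ 1 / 24) (hea : e * a ≤ 1 / 24)
    (hab' : 1 / 72 < a * b) (hbc' : 1 / 72 < b * c)
    (hcd' : 1 / 72 < c * d) (hde' : 1 / 72 < d * e) (hea' : 1 / 72 < e * a) :
    a * b * c + b * c * d + c * d * e + d * e * a + e * a * b - 24 * (a * b * c * d * e) ≤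
      1 / 27 := by
  obtain ⟨h1, h1'⟩ := inv_sub_one_mem hab' hab
  obtain ⟨h2, h2'⟩ := inv_sub_one_mem hbc' hbc
  obtain ⟨h3, h3'⟩ := inv_sub_one_mem hcd' hcd
  obtain ⟨h4, h4'⟩ := inv_sub_one_mem hde' hde
  obtain ⟨h5, h5'⟩ := inv_sub_one_mem hea' hea
  have key := sq_sum_sub_one_le h1 h2 h3 h4 h5 h1' h2' h3' h4' h5'
  have e1 : a * b * c + b * c * d + c * d * e + d * e * a + e * a * b -
      24 * (a * b * c * d * e) = 24 * (a * b * c * d * e) *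
      (4 + ((24 * (a * b))⁻¹ - 1 + ((24 * (b * c))⁻¹ - 1) + ((24 * (c * d))⁻¹ - 1) +
        ((24 * (d * e))⁻¹ - 1) + ((24 * (e * a))⁻¹ - 1))) := by
    field_simp
    ring
  have e2 : (24 * (a * b * c * d * e)) ^ 2 * (16 * ((1 + ((24 * (a * b))⁻¹ - 1)) *
      (1 + ((24 * (b * c))⁻¹ - 1)) * (1 + ((24 * (c * d))⁻¹ - 1)) *
      (1 + ((24 * (d * e))⁻¹ - 1)) * (1 + ((24 * (e * a))⁻¹ - 1)))) = 1 / 864 := by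
    simp only [add_sub_cancel]
    field_simp
    norm_num
  rw [e1]
  refine abs_le_of_sq_le_sq' ?_ (by norm_num) |>.2
  rw [mul_pow]
  refine (mul_le_mul_of_nonneg_left key (sq_nonneg _)).trans ?_
  rw [e2]
  norm_num

lemma quintuple_le {a b c d e : ℝ} (ha : 0 ≤ a) (hb : 0 ≤ b) (hc : 0 ≤ c) (hd : 0 ≤ d)
    (he : 0 ≤ e) (h : a + b + c + d + e = 1) (hab : a * b ≤ 1 / 24) (hbc : b * c ≤ 1 / 24)
    (hcd : c * d ≤ 1 / 24) (hde : d * e ≤ 1 / 24) (hea : e * a ≤ 1 / 24) :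
    a * b * c + b * c * d + c * d * e + d * e * a + e * a * b - 24 * (a * b * c * d * e) ≤
      1 / 27 := by
  have h5 : 0 ≤ a * b * c * d * e := by positivity
  by_cases h1 : a * b ≤ 1 / 72
  · linarith [quintuple_cubic_le ha hb hc hd he h h1 hbc hcd hde hea]
  by_cases h2 : b * c ≤ 1 / 72
  · linarith [quintuple_cubic_le hb hc hd he ha (by linarith) h2 hcd hde hea hab]
  by_cases h3 : c * d ≤ 1 / 72
  · linarith [quintuple_cubic_le hc hd he ha hb (by linarith) h3 hde hea hab hbc]
  by_cases h4 : d * e ≤ 1 / 72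
  · linarith [quintuple_cubic_le hd he ha hb hc (by linarith) h4 hea hab hbc hcd]
  by_cases h5 : e * a ≤ 1 / 72
  · linarith [quintuple_cubic_le he ha hb hc hd (by linarith) h5 hab hbc hcd hde]
  push Not at h1 h2 h3 h4 h5
  have pos : ∀ {x y : ℝ}, 0 ≤ x → 1 / 72 < x * y → 0 < x := fun hx hxy =>
    hx.lt_of_ne (by rintro rfl; norm_num at hxy)
  exact quintuple_le_of_large (pos ha h1) (pos hb h2) (pos hc h3) (pos hd h4) (pos he h5)
    hab hbc hcd hde hea h1 h2 h3 h4 h5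

/-- The product formula for the second derivatives of the quintic coefficient at two neighbouring
places. -/
lemma pairSum_drop_add_pairSum_drop {l : List ℝ} (h : Odd l.length) (h5 : 5 ≤ l.length) (i : ℕ) :
    4 * (pairSum ((l.rotate i).drop 3) + pairSum ((l.rotate (i + 1)).drop 3)) =
      (l.sum - altSum (l.rotate (i + 2))) *
      (l.sum - altSum (l.rotate (i + 1)) - altSum (l.rotate (i + 2)) -
        altSum (l.rotate (i + 3))) := by
  have h1 := altSum_add_altSum_rotate_succ h (i + 1)
  have h2 := altSum_add_altSum_rotate_succ h (i + 2)
  rw [show i + 1 + 1 = i + 2 by ring] at h1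
  rw [show i + 2 + 1 = i + 3 by ring] at h2
  have hs : (l.rotate i).sum = l.sum := (List.rotate_perm l _).sum_eq
  have h' : (l.rotate i).length = l.length := List.length_rotate _ _
  rw [← List.rotate_rotate l i 1] at h1 ⊢
  rw [← List.rotate_rotate l i 2] at h1 h2 ⊢
  rcases hl : l.rotate i with _ | ⟨w, _ | ⟨a, _ | ⟨b, _ | ⟨c, r⟩⟩⟩⟩
  iterate 4 (simp [hl] at h'; omega)
  have hr : Odd r.length := by
    rw [hl] at h'
    rw [← h'] at h
    simp only [List.length_cons] at h
    grind
  rw [hl] at hs h1 h2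
  -- The two tails overlap in `r`, and `c :: r ++ [w]` omits just `a` and `b`. Its sum and
  -- alternating sum give a difference of squares, which factors as claimed.
  have e3 : altSum ((w :: a :: b :: c :: r).rotate 2) = a + b - altSum (c :: r ++ [w]) := by
    have : (w :: a :: b :: c :: r).rotate 2 = b :: (c :: r ++ [w] ++ [a]) := by
      simp [List.rotate_cons_succ]
    rw [this, altSum_cons, altSum_append, altSum_singleton, Odd.neg_one_pow]
    · ring
    · simp only [List.cons_append, List.length_cons, List.length_append, List.length_nil]
      grind
  have e4 := pairSum_add_pairSum c w r hr
  have e5 : ((w :: a :: b :: c :: r).rotate 1).drop 3 = r ++ [w] := by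
    simp [List.rotate_cons_succ]
  rw [e5]
  have e6 : (w :: a :: b :: c :: r).drop 3 = c :: r := rfl
  rw [e6, e4]
  have e7 : (c :: r ++ [w]).sum = l.sum - a - b := by
    rw [← hs]; simp; ring
  simp only [List.rotate_cons_succ, List.rotate_zero, List.cons_append, List.headD_cons] at h1 h2
  simp only [List.rotate_cons_succ, List.rotate_zero, List.cons_append] at e3 ⊢
  have e8 := evenSum_mul_oddSum (c :: r ++ [w])
  rw [e7] at e8
  rw [List.cons_append] at e8
  rw [e8]
  rw [eq_sub_of_add_eq h1, eq_sub_of_add_eq' h2, e3]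
  ring

/-- If all these values are below `1/24`, the product formula bounds the alternating sums locally;
summing around the cycle leaves room for at most six gaps. -/
lemma exists_pairSum_large {l : List ℝ} (h : Odd l.length) (h7 : 7 ≤ l.length)
    (hl : ∀ x ∈ l, 0 ≤ x) (hs : l.sum = 1) (hp : 1 / 27 < cubicSum l) :
    ∃ i, 1 ≤ 24 * pairSum ((l.rotate i).drop 3) := by
  by_contra! H
  have hcube := altSum_rotate_cube_le h (by omega) hl
  have hle : ∀ i, altSum (l.rotate i) ≤ 1 / 2 := by
    intro i
    by_contra! hi
    -- The cube would exceed `1/8`, whereas `c₃ > 1/27` forces it below `1 - 24/27 = 1/9`.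
    have := pow_lt_pow_left₀ hi (by norm_num) (n := 3) (by norm_num)
    have := hcube i
    rw [hs] at this
    norm_num at *
    linarith
  have hge : ∀ i, -(1 / 2) ≤ altSum (l.rotate i) := fun i => by
    linarith [altSum_add_nonneg h hl i, hle (i + 1)]
  have key : ∀ i ∈ Finset.range l.length, 1 - altSum (l.rotate (i + 1)) -
      altSum (l.rotate (i + 2)) - altSum (l.rotate (i + 3)) ≤
      4 / 9 * (1 + altSum (l.rotate (i + 2))) := by
    intro i _
    have h1 := pairSum_drop_add_pairSum_drop h (by omega) i
    rw [hs] at h1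
    have h2 := H i
    have h3 := H (i + 1)
    have h4 := hle (i + 2)
    have h5 := hge (i + 2)
    -- Otherwise the product would exceed `4/9 * (1 - A²) ≥ 1/3`, because `|A| ≤ 1/2`, while the two
    -- pair sums keep it below `1/3`.
    by_contra! h6
    nlinarith
  have := Finset.sum_le_sum key
  simp only [Finset.sum_sub_distrib, ← Finset.mul_sum, Finset.sum_add_distrib,
    sum_range_rotate_add altSum, sum_altSum_rotate h, hs, Finset.sum_const, Finset.card_range] at this
  have h7' : (7 : ℝ) ≤ l.length := by exact_mod_cast h7
  simp at this
  -- With `n` gaps the sum reads `n - 3 ≤ 4/9 * (n + 1)`, which fails for `n ≥ 7`.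
  linarith

theorem potential_le {l : List ℝ} (h : Odd l.length) (hl : ∀ x ∈ l, 0 ≤ x) (hs : l.sum = 1) :
    potential l ≤ 1 / 27 := by
  obtain ⟨m, hm⟩ := h
  induction m generalizing l with
  | zero =>
    obtain ⟨a, rfl⟩ := List.length_eq_one_iff.1 hm
    rw [potential_singleton]; norm_num
  | succ m ih =>
    rcases Nat.eq_zero_or_pos m with rfl | hm0
    · obtain ⟨a, b, c, rfl⟩ := List.length_eq_three.1 hm
      rw [potential_triple]
      simp only [List.mem_cons, forall_eq_or_imp, List.sum_cons, List.sum_nil] at hl hs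
      exact prod_three_le hl.1 hl.2.1 hl.2.2.1 (by linarith)
    by_cases H : ∃ i, 1 ≤ 24 * pairSum ((l.rotate i).drop 3)
    · obtain ⟨i, hi⟩ := H
      rw [← potential_rotate l i]
      have hl' : ∀ x ∈ l.rotate i, 0 ≤ x := fun x hx => hl x (List.mem_rotate.1 hx)
      have hs' : (l.rotate i).sum = 1 := by rw [(List.rotate_perm l _).sum_eq, hs]
      have hm' : (l.rotate i).length = 2 * (m + 1) + 1 := by rw [List.length_rotate, hm]
      generalize l.rotate i = L at *
      rcases L with _ | ⟨a, _ | ⟨u, _ | ⟨b, r⟩⟩⟩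
      iterate 3 (simp at hm'; try omega)
      simp only [List.length_cons] at hm'
      simp only [List.drop_succ_cons, List.drop_zero] at hi
      simp only [List.mem_cons, forall_eq_or_imp] at hl'
      obtain ⟨ha, hu, hb, hr⟩ := hl'
      simp only [List.sum_cons] at hs'
      refine (potential_le_max a u b (by grind) ha hu hb hi).trans (max_le ?_ ?_)
      · rcases r with _ | ⟨x, r⟩
        · simp at hm'; omega
        simp only [List.mem_cons, forall_eq_or_imp] at hr
        -- The zero gap lies between `u` and the first gap of the rest; rotating exposes the pattern
        -- for merging.
        rw [show (a + b) :: u :: 0 :: x :: r = [a + b] ++ (u :: 0 :: x :: r) from rfl,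
          potential_append_comm, List.cons_append, List.cons_append, List.cons_append,
          potential_merge]
        apply ih
        · simp only [List.mem_cons, List.mem_append, List.not_mem_nil, or_false]
          rintro y (rfl | hy | rfl)
          · linarith
          · exact hr.2 y hy
          · linarith
        · simp at hs' ⊢; linarith
        · simp at hm' ⊢; omega
      · rcases List.eq_nil_or_concat r with rfl | ⟨r, x, rfl⟩
        · simp at hm'; omega
        have hx : 0 ≤ x := hr x (by simp)
        rw [show 0 :: u :: (a + b) :: (r.concat x) = (0 :: u :: (a + b) :: r) ++ [x] by simp,
          potential_append_comm, List.singleton_append, potential_merge]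
        apply ih
        · simp only [List.mem_cons]
          rintro y (rfl | rfl | hy)
          · linarith
          · linarith
          · exact hr y (by simp [hy])
        · simp at hs' ⊢; linarith
        · simp at hm' ⊢; omega
    · rcases Nat.lt_or_ge 1 m with h1 | h1
      · have hp : cubicSum l ≤ 1 / 27 := by
          by_contra! hp
          exact H (exists_pairSum_large ⟨m + 1, hm⟩ (by omega) hl hs hp)
        have := quinticSum_nonneg hl
        rw [potential]
        linarith
      · obtain rfl : m = 1 := by omega
        push Not at H
        rcases l with _ | ⟨a, _ | ⟨b, _ | ⟨c, _ | ⟨d, _ | ⟨e, _ | _⟩⟩⟩⟩⟩ <;> simp at hm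
        have h0 := H 0
        have h1 := H 1
        have h2 := H 2
        have h3 := H 3
        have h4 := H 4
        simp only [List.rotate_cons_succ, List.rotate_zero, List.cons_append, List.nil_append,
          List.drop_succ_cons, List.drop_zero, pairSum_pair] at h0 h1 h2 h3 h4
        simp only [List.mem_cons, forall_eq_or_imp, List.sum_cons, List.sum_nil] at hl hs
        rw [potential_quintuple]
        apply quintuple_le hl.1 hl.2.1 hl.2.2.1 hl.2.2.2.1 hl.2.2.2.2.1 <;> linarith

end PotentialBound

end Herman

namespace Herman

/-! ### Changing the token weight, and the resulting drift. -/

section Homogenization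

open Polynomial Matrix

/-- Homogenization of a polynomial to degree `n`, where `X` has degree one and `t` degree two. -/
noncomputable def homogenize (t : ℝ[X]) (n : ℕ) (p : ℝ[X]) : ℝ[X] :=
  ∑ r ∈ Finset.range (n + 1), C (p.coeff r) * (X ^ r * t ^ ((n - r) / 2))

lemma homogenize_add (t : ℝ[X]) (n : ℕ) (p q : ℝ[X]) :
    homogenize t n (p + q) = homogenize t n p + homogenize t n q := by
  simp only [homogenize, coeff_add, C_add, add_mul, Finset.sum_add_distrib]

lemma homogenize_C_mul (t : ℝ[X]) (n : ℕ) (a : ℝ) (p : ℝ[X]) :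
    homogenize t n (C a * p) = C a * homogenize t n p := by
  simp only [homogenize, coeff_C_mul, C_mul, mul_assoc, Finset.mul_sum]

lemma homogenize_X_mul (t : ℝ[X]) (n : ℕ) (p : ℝ[X]) :
    homogenize t (n + 1) (X * p) = X * homogenize t n p := by
  rw [homogenize, Finset.sum_range_succ', homogenize, Finset.mul_sum, coeff_X_mul_zero, C_0,
    zero_mul, add_zero]
  refine Finset.sum_congr rfl fun r _ => ?_
  rw [coeff_X_mul, Nat.add_sub_add_right, pow_succ]
  ring

lemma homogenize_add_two (t : ℝ[X]) (n : ℕ) {p : ℝ[X]} (hp : p.natDegree ≤ n) :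
    homogenize t (n + 2) p = t * homogenize t n p := by
  rw [homogenize, Finset.sum_range_succ, Finset.sum_range_succ,
    coeff_eq_zero_of_natDegree_lt (by omega), coeff_eq_zero_of_natDegree_lt (by omega), homogenize,
    Finset.mul_sum, C_0, zero_mul, add_zero, zero_mul, add_zero]
  refine Finset.sum_congr rfl fun r hr => ?_
  rw [Finset.mem_range] at hr
  rw [show (n + 2 - r) / 2 = (n - r) / 2 + 1 by omega, pow_succ]
  ring

lemma natDegree_transfer_le (l : List ℝ) (i j : Fin 2) :
    (transfer 1 l i j).natDegree ≤ l.length := by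
  induction l generalizing i j with
  | nil =>
    rw [transfer_nil, Matrix.one_apply]
    split_ifs <;> simp
  | cons a l ih =>
    match i with
    | 0 =>
      rw [transfer_cons_zero, one_mul, List.length_cons, mul_assoc]
      refine (natDegree_add_le _ _).trans (max_le ?_ ((ih 1 j).trans (by omega)))
      refine (natDegree_C_mul_le _ _).trans (natDegree_mul_le.trans ?_)
      rw [natDegree_X]
      have := ih 0 j
      omega
    | 1 =>
      rw [transfer_cons_one, List.length_cons]
      exact (ih 0 j).trans (by omega)

/-- Omitting two adjacent gaps costs one factor `t`, so `t` counts as degree two. Off-diagonal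
entries have the other parity, hence degree `l.length + 1`; the extra `t` on the lower left entry
closes the induction. -/
lemma transfer_eq_homogenize (t : ℝ[X]) (l : List ℝ) :
    transfer t l 0 0 = homogenize t l.length (transfer 1 l 0 0) ∧
    t * transfer t l 1 0 = homogenize t (l.length + 1) (transfer 1 l 1 0) ∧
    transfer t l 0 1 = homogenize t (l.length + 1) (transfer 1 l 0 1) ∧
    transfer t l 1 1 = homogenize t l.length (transfer 1 l 1 1) := by
  induction l with
  | nil => simp [homogenize]
  | cons a l ih =>
    obtain ⟨h1, h2, h3, h4⟩ := ih
    simp only [transfer_cons_zero, transfer_cons_one, List.length_cons, one_mul, homogenize_add,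
      mul_assoc, homogenize_C_mul, homogenize_X_mul]
    refine ⟨?_, ?_, ?_, ?_⟩
    · rw [h1, h2]
    · rw [h1, homogenize_add_two _ _ (natDegree_transfer_le _ _ _)]
    · rw [h3, h4, homogenize_add_two _ _ (natDegree_transfer_le _ _ _)]
    · rw [h3]

lemma trace_transfer_eq_homogenize (t : ℝ[X]) (l : List ℝ) :
    trace (transfer t l) = homogenize t l.length (trace (transfer 1 l)) := by
  obtain ⟨h1, -, -, h4⟩ := transfer_eq_homogenize t l
  rw [Matrix.trace_fin_two, Matrix.trace_fin_two, homogenize_add, h1, h4]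

lemma coeff_homogenize (t : ℝ[X]) (n s : ℕ) {p : ℝ[X]} (hp : p.natDegree ≤ n) :
    (homogenize t n p).coeff s =
      ∑ r ∈ Finset.range (s + 1), p.coeff r * (t ^ ((n - r) / 2)).coeff (s - r) := by
  have h1 : (homogenize t n p).coeff s = ∑ r ∈ Finset.range (n + 1),
      if r ≤ s then p.coeff r * (t ^ ((n - r) / 2)).coeff (s - r) else 0 := by
    rw [homogenize, finsetSum_coeff]
    refine Finset.sum_congr rfl fun r _ => ?_
    rw [coeff_C_mul, coeff_X_pow_mul', mul_ite, mul_zero]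
  have h2 : ∑ r ∈ Finset.range (s + 1), p.coeff r * (t ^ ((n - r) / 2)).coeff (s - r) =
      ∑ r ∈ Finset.range (s + 1),
        if r ≤ s then p.coeff r * (t ^ ((n - r) / 2)).coeff (s - r) else 0 :=
    Finset.sum_congr rfl fun r hr => by rw [Finset.mem_range] at hr; rw [if_pos (by omega)]
  rw [h1, h2]
  rcases le_total n s with h | h
  · refine Finset.sum_subset (Finset.range_subset_range.2 (by omega)) fun r _ hr => ?_
    rw [Finset.mem_range] at hr
    rw [coeff_eq_zero_of_natDegree_lt (by omega)]
    simp
  · refine (Finset.sum_subset (Finset.range_subset_range.2 (by omega)) fun r _ hr => ?_).symm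
    rw [Finset.mem_range] at hr
    rw [if_neg (by omega)]

lemma coeff_pow_one_sub (k : ℝ) (j : ℕ) :
    ((1 - C k * X ^ 2 : ℝ[X]) ^ j).coeff 0 = 1 ∧ ((1 - C k * X ^ 2 : ℝ[X]) ^ j).coeff 1 = 0 ∧
    ((1 - C k * X ^ 2 : ℝ[X]) ^ j).coeff 2 = -(j * k) ∧
    ((1 - C k * X ^ 2 : ℝ[X]) ^ j).coeff 3 = 0 ∧
    0 ≤ ((1 - C k * X ^ 2 : ℝ[X]) ^ j).coeff 4 ∧
    ((1 - C k * X ^ 2 : ℝ[X]) ^ j).coeff 5 = 0 := by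
  induction j with
  | zero => simp [coeff_one]
  | succ j ih =>
    obtain ⟨h0, h1, h2, h3, h4, h5⟩ := ih
    have key : ∀ s, ((1 - C k * X ^ 2 : ℝ[X]) ^ (j + 1)).coeff s =
        ((1 - C k * X ^ 2 : ℝ[X]) ^ j).coeff s -
        k * (if 2 ≤ s then ((1 - C k * X ^ 2 : ℝ[X]) ^ j).coeff (s - 2) else 0) := by
      intro s
      rw [pow_succ', sub_mul, one_mul, mul_assoc, coeff_sub, coeff_C_mul, coeff_X_pow_mul']
    simp only [key]
    norm_num [h0, h1, h2, h3, h5]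
    refine ⟨by ring, ?_⟩
    have : 0 ≤ k * (j * k) := by nlinarith [mul_nonneg (Nat.cast_nonneg (α := ℝ) j) (sq_nonneg k)]
    linarith

lemma natDegree_trace_transfer_le (l : List ℝ) : (trace (transfer 1 l)).natDegree ≤ l.length := by
  rw [Matrix.trace_fin_two]
  exact (natDegree_add_le _ _).trans
    (max_le (natDegree_transfer_le _ _ _) (natDegree_transfer_le _ _ _))

lemma coeff_three_trace_transfer (k : ℝ) {l : List ℝ} {m : ℕ} (hm : l.length = 2 * m + 1) :
    (trace (transfer (1 - C k * X ^ 2) l)).coeff 3 = cubicSum l - m * k * l.sum := by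
  rw [trace_transfer_eq_homogenize, coeff_homogenize _ _ _ (natDegree_trace_transfer_le l), hm]
  simp only [Finset.sum_range_succ, Finset.sum_range_zero]
  norm_num [coeff_pow_one_sub, coeff_trace_one ⟨m, hm⟩, cubicSum]
  ring

/-- The correction from the linear coefficient is second order in `k` and nonnegative, so it is
dropped. -/
lemma coeff_five_trace_transfer (k : ℝ) {l : List ℝ} {m : ℕ} (hm : l.length = 2 * (m + 1) + 1)
    (hl : 0 ≤ l.sum) :
    quinticSum l - m * k * cubicSum l ≤
      (trace (transfer (1 - C k * X ^ 2) l)).coeff 5 := by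
  rw [trace_transfer_eq_homogenize, coeff_homogenize _ _ _ (natDegree_trace_transfer_le l), hm]
  have e3 : (2 * (m + 1) + 1 - 3) / 2 = m := by omega
  have h4 := mul_nonneg hl (coeff_pow_one_sub k ((2 * (m + 1) + 1 - 1) / 2)).2.2.2.2.1
  simp only [Finset.sum_range_succ, Finset.sum_range_zero, e3, Nat.reduceSub, Nat.sub_self,
    coeff_pow_one_sub, coeff_trace_one ⟨m + 1, hm⟩]
  rw [cubicSum, quinticSum]
  linarith

/-- The drift inequality for the potential of a list of gaps of total length one. -/
lemma potential_drift {k : ℝ} (hk : 0 ≤ k) {l : List ℝ} (h : Odd l.length) (h3 : 3 ≤ l.length)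
    (hl : ∀ x ∈ l, 0 ≤ x) (hs : l.sum = 1) :
    (trace (transfer (1 - C k * X ^ 2) l)).coeff 3 -
      24 * (trace (transfer (1 - C k * X ^ 2) l)).coeff 5 ≤ potential l - k := by
  have hc := cubicSum_le h h3 hl
  obtain ⟨m, hm⟩ := h
  obtain ⟨m, rfl⟩ : ∃ m', m = m' + 1 := ⟨m - 1, by omega⟩
  have h5 := coeff_five_trace_transfer k hm (by rw [hs]; norm_num)
  have h6 := coeff_three_trace_transfer k hm
  rw [hs] at hc h6
  rw [h6, potential]
  -- The cubic coefficient loses `(m + 1) * k`, and the quintic correction returns at most `m * k`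
  -- because `24 c₃ ≤ 1`. This is where the factor 24 enters the drift.
  have h7 : (m : ℝ) * k * (24 * cubicSum l) ≤ m * k * 1 :=
    mul_le_mul_of_nonneg_left (by linarith) (by positivity)
  push_cast
  linarith

end Homogenization

/-! ### The continuant as a product over processes, averaged over the coins. -/

section RingTrace

open Polynomial Matrix

/-- The transfer matrix of a stretch of the ring of length `a` without tokens. -/
noncomputable def emptyMatrix (a : ℝ) : Matrix (Fin 2) (Fin 2) ℝ[X] := !![1, C a * X; 0, 1]

/-- The transfer matrix of a token with weight `t`. -/
noncomputable def tokenMatrix (t : ℝ[X]) : Matrix (Fin 2) (Fin 2) ℝ[X] := !![0, t; 1, 0]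

lemma emptyMatrix_mul (a b : ℝ) : emptyMatrix a * emptyMatrix b = emptyMatrix (a + b) := by
  ext i j : 2
  fin_cases i <;> fin_cases j <;> simp [emptyMatrix, Matrix.mul_apply, Fin.sum_univ_two, add_mul,
    add_comm]

lemma emptyMatrix_mul_gapMatrix (t : ℝ[X]) (a g : ℝ) :
    emptyMatrix a * gapMatrix t g = gapMatrix t (a + g) := by
  ext i j : 2
  fin_cases i <;> fin_cases j <;>
    simp [emptyMatrix, gapMatrix, Matrix.mul_apply, Fin.sum_univ_two, add_mul, add_comm]

lemma emptyMatrix_mul_tokenMatrix (t : ℝ[X]) (a : ℝ) :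
    emptyMatrix a * tokenMatrix t = gapMatrix t a := by
  ext i j : 2
  fin_cases i <;> fin_cases j <;>
    simp [emptyMatrix, gapMatrix, tokenMatrix, Matrix.mul_apply, Fin.sum_univ_two]

lemma tokenMatrix_mul_self : tokenMatrix 1 * tokenMatrix 1 = 1 := by
  ext i j : 2
  fin_cases i <;> fin_cases j <;>
    simp [tokenMatrix, Matrix.mul_apply, Fin.sum_univ_two]

/-- The ring is cut open, so an incomplete stretch of length `r` remains after the last token;
closing the trace joins it to the first gap. -/
lemma exists_gaps_of_list {w : ℝ} (hw : 0 ≤ w) (l : List Bool) :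
    ∃ (gs : List ℝ) (r : ℝ), gs.length = l.count true ∧ 0 ≤ r ∧ (∀ x ∈ gs, 0 ≤ x) ∧
      gs.sum + r = w * l.length ∧ ∀ t : ℝ[X],
        (l.map fun b => emptyMatrix w * if b then tokenMatrix t else 1).prod =
          transfer t gs * emptyMatrix r := by
  induction l with
  | nil =>
    refine ⟨[], 0, rfl, le_rfl, by simp, by simp, fun t => ?_⟩
    ext i j : 2
    fin_cases i <;> fin_cases j <;> simp [emptyMatrix]
  | cons b l ih =>
    obtain ⟨gs, r, h1, h2, h3, h4, h5⟩ := ih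
    cases b with
    | true =>
      refine ⟨w :: gs, r, by simp [h1], h2, ?_, ?_, fun t => ?_⟩
      · simpa using ⟨hw, h3⟩
      · simp; linarith
      · rw [List.map_cons, List.prod_cons, h5, transfer_cons, if_pos rfl, emptyMatrix_mul_tokenMatrix,
          Matrix.mul_assoc]
    | false =>
      rcases gs with _ | ⟨g, gs⟩
      · refine ⟨[], w + r, by simpa using h1, by positivity, by simp, ?_, fun t => ?_⟩
        · simp at h4 ⊢; linarith
        · rw [List.map_cons, List.prod_cons, h5]
          simp [emptyMatrix_mul]
      · simp only [List.mem_cons, forall_eq_or_imp] at h3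
        refine ⟨(w + g) :: gs, r, by simpa using h1, h2, ?_, ?_, fun t => ?_⟩
        · simpa using ⟨add_nonneg hw h3.1, h3.2⟩
        · simp at h4 ⊢; linarith
        · rw [List.map_cons, List.prod_cons, h5, transfer_cons, transfer_cons,
            ← emptyMatrix_mul_gapMatrix]
          simp [Matrix.mul_assoc]

/-- The trace of the product of the transfer matrices around the ring, with unit length `w`. -/
noncomputable def ringTrace (w : ℝ) (t : ℝ[X]) {N : ℕ} (z : Config N) : ℝ[X] :=
  trace (List.ofFn fun i : Fin N => emptyMatrix w * if i ∈ z then tokenMatrix t else 1).prod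

lemma exists_gaps {w : ℝ} (hw : 0 ≤ w) {N : ℕ} (z : Config N) (hz : z.Nonempty) :
    ∃ gs : List ℝ, gs.length = z.card ∧ (∀ x ∈ gs, 0 ≤ x) ∧ gs.sum = w * N ∧
      ∀ t : ℝ[X], ringTrace w t z = trace (transfer t gs) := by
  obtain ⟨gs, r, h1, h2, h3, h4, h5⟩ :=
    exists_gaps_of_list hw (List.ofFn fun i : Fin N => decide (i ∈ z))
  have hc : (List.ofFn fun i : Fin N => decide (i ∈ z)).count true = z.card := by
    rw [List.ofFn_eq_map, List.count, List.countP_map, List.countP_eq_length_filter]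
    conv_rhs => rw [← Finset.filter_univ_mem z]
    simp [Finset.card, Finset.filter, Finset.univ, Fintype.elems]
    rfl
  rw [hc] at h1
  rcases gs with _ | ⟨g, gs⟩
  · simp at h1
    exact absurd h1.symm hz.card_pos.ne'
  simp only [List.mem_cons, forall_eq_or_imp] at h3
  refine ⟨(r + g) :: gs, by simpa using h1, ?_, ?_, fun t => ?_⟩
  · simpa using ⟨add_nonneg h2 h3.1, h3.2⟩
  · simp at h4 ⊢; linarith
  · have := h5 t
    rw [List.map_ofFn] at this
    rw [ringTrace]
    simp only [Function.comp_def, decide_eq_true_eq] at this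
    rw [this, Matrix.trace_mul_comm, transfer_cons, transfer_cons, ← Matrix.mul_assoc,
      emptyMatrix_mul_gapMatrix]

lemma prod_ofFn_mul_castSucc {R : Type*} [Monoid R] {n : ℕ} (A K : Fin (n + 1) → R) :
    (List.ofFn fun i => K i * A i).prod =
      K 0 * (List.ofFn fun i : Fin n => A i.castSucc * K i.succ).prod * A (Fin.last n) := by
  induction n with
  | zero => simp
  | succ n ih =>
    rw [List.ofFn_succ, List.prod_cons, ih (fun i => A i.succ) (fun i => K i.succ), List.ofFn_succ,
      List.prod_cons]
    simp only [mul_assoc, Fin.castSucc_zero, Fin.succ_last, Fin.succ_castSucc]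

lemma finRotate_symm_succ {n : ℕ} (i : Fin n) :
    (finRotate (n + 1)).symm i.succ = i.castSucc := by
  rw [Equiv.symm_apply_eq, finRotate_apply, Fin.coeSucc_eq_succ]

lemma finRotate_symm_zero {n : ℕ} : (finRotate (n + 1)).symm 0 = Fin.last n := by
  rw [Equiv.symm_apply_eq, finRotate_last]

/-- Regroups factors by the process they come from instead of the one they arrive at; the factor
crossing the cut is moved by cyclicity. -/
lemma trace_prod_ofFn_rotate {N : ℕ} (A K : Fin N → Matrix (Fin 2) (Fin 2) ℝ[X]) :
    trace (List.ofFn fun i => A ((finRotate N).symm i) * K i).prod =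
      trace (List.ofFn fun i => K i * A i).prod := by
  cases N with
  | zero => simp
  | succ n =>
    rw [prod_ofFn_mul_castSucc A K, Matrix.trace_mul_comm,
      List.ofFn_succ (f := fun i => A ((finRotate (n + 1)).symm i) * K i), List.prod_cons]
    simp only [finRotate_symm_zero, finRotate_symm_succ, Matrix.mul_assoc]

/-- Independence of the coins, as noncommutative distributivity. -/
lemma sum_prod_ofFn {R : Type*} [Semiring R] {N : ℕ} (W : Fin N → Bool → R) :
    ∑ c : Fin N → Bool, (List.ofFn fun i => W i (c i)).prod =
      (List.ofFn fun i => W i true + W i false).prod := by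
  induction N with
  | zero => simp
  | succ n ih =>
    rw [← (Fin.consEquiv fun _ => Bool).sum_comp, Fintype.sum_prod_type]
    simp only [List.ofFn_succ, List.prod_cons, Fin.consEquiv_apply, Fin.cons_zero, Fin.cons_succ]
    simp only [← Finset.mul_sum, ih (fun i => W i.succ), Fintype.sum_bool, add_mul]

lemma prod_ofFn_smul {N : ℕ} (a : ℝ[X]) (f : Fin N → Matrix (Fin 2) (Fin 2) ℝ[X]) :
    (List.ofFn fun i => a • f i).prod = a ^ N • (List.ofFn f).prod := by
  induction N with
  | zero => simp
  | succ n ih =>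
    rw [List.ofFn_succ, List.prod_cons, ih, List.ofFn_succ, List.prod_cons, smul_mul_smul_comm,
      pow_succ']

lemma mem_step_iff {N : ℕ} (z : Config N) (c : Flips N) (i : Fin N) :
    i ∈ step z c ↔ Xor (i ∈ z ∧ c i = false)
      ((finRotate N).symm i ∈ z ∧ c ((finRotate N).symm i) = true) := by
  rw [step, Finset.mem_symmDiff, Finset.mem_filter, Finset.mem_map_equiv, Finset.mem_filter]
  rfl

lemma tokenMatrix_xor (p q : Prop) [Decidable p] [Decidable q] [Decidable (Xor p q)] :
    (if Xor p q then tokenMatrix 1 else 1) =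
      (if q then tokenMatrix 1 else 1) * (if p then tokenMatrix 1 else 1) := by
  by_cases hp : p <;> by_cases hq : q <;> simp [hp, hq, tokenMatrix_mul_self, Xor]

/-- Keeping and passing put the token at the two ends of an edge. Their average is a token at the
midpoint with a smaller weight. -/
lemma half_emptyMatrix_token (w : ℝ) :
    tokenMatrix 1 * emptyMatrix w + emptyMatrix w * tokenMatrix 1 =
      (2 : ℝ[X]) • (emptyMatrix (w / 2) *
        (tokenMatrix (1 - C (w ^ 2 / 4) * X ^ 2) * emptyMatrix (w / 2))) := by
  obtain ⟨v, rfl⟩ : ∃ v, w = 2 * v := ⟨w / 2, by ring⟩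
  have h1 : C (2 * v) = (2 : ℝ[X]) * C v := by rw [C_mul]; rfl
  have h2 : C ((2 * v) ^ 2 / 4) = C v ^ 2 := by rw [← C_pow]; congr 1; ring
  rw [mul_div_cancel_left₀ v two_ne_zero, h2]
  ext i j : 1
  fin_cases i <;> fin_cases j <;>
    simp only [emptyMatrix, tokenMatrix, Matrix.mul_apply, Fin.sum_univ_two, h1, Matrix.add_apply,
      Matrix.smul_apply, smul_eq_mul, Matrix.of_apply, Matrix.cons_val', Matrix.cons_val_zero,
      Matrix.cons_val_one, Matrix.cons_val_fin_one, Fin.zero_eta, Fin.mk_one, Fin.isValue] <;>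
    ring

/-- The contribution of process `i` to the ring trace after a step in which its coin shows `b`. -/
noncomputable def stepMatrix (w : ℝ) {N : ℕ} (z : Config N) (i : Fin N) (b : Bool) :
    Matrix (Fin 2) (Fin 2) ℝ[X] :=
  (if i ∈ z ∧ b = false then tokenMatrix 1 else 1) *
    (emptyMatrix w * (if i ∈ z ∧ b = true then tokenMatrix 1 else 1))

lemma ringTrace_step (w : ℝ) {N : ℕ} (z : Config N) (c : Flips N) :
    ringTrace w 1 (step z c) = trace (List.ofFn fun i => stepMatrix w z i (c i)).prod := by
  classical
  have h := trace_prod_ofFn_rotate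
    (fun i => emptyMatrix w * (if i ∈ z ∧ c i = true then tokenMatrix 1 else 1))
    (fun i => if i ∈ z ∧ c i = false then tokenMatrix 1 else 1)
  simp only [stepMatrix]
  rw [← h, ringTrace]
  simp only [mem_step_iff, tokenMatrix_xor, Matrix.mul_assoc]

lemma stepMatrix_add (w : ℝ) {N : ℕ} (z : Config N) (i : Fin N) :
    stepMatrix w z i true + stepMatrix w z i false =
      (2 : ℝ[X]) • (emptyMatrix (w / 2) *
        ((if i ∈ z then tokenMatrix (1 - C (w ^ 2 / 4) * X ^ 2) else 1) * emptyMatrix (w / 2))) := by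
  by_cases hi : i ∈ z
  · simp only [stepMatrix, hi, true_and, if_true, Bool.true_eq_false, Bool.false_eq_true, if_false,
      Matrix.one_mul, Matrix.mul_one]
    rw [add_comm, half_emptyMatrix_token]
  · simp only [stepMatrix, hi, false_and, if_false, Matrix.one_mul, Matrix.mul_one,
      emptyMatrix_mul, add_halves, two_smul]

lemma trace_prod_half_emptyMatrix (w : ℝ) {N : ℕ} (Y : Fin N → Matrix (Fin 2) (Fin 2) ℝ[X]) :
    trace (List.ofFn fun i => emptyMatrix (w / 2) * (Y i * emptyMatrix (w / 2))).prod =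
      trace (List.ofFn fun i => emptyMatrix w * Y i).prod := by
  have h1 := trace_prod_ofFn_rotate (fun _ => emptyMatrix (w / 2))
    (fun i => Y i * emptyMatrix (w / 2))
  have h2 := trace_prod_ofFn_rotate (fun _ => emptyMatrix w) Y
  rw [h1, h2]
  simp only [Matrix.mul_assoc, emptyMatrix_mul, add_halves]

lemma sum_ringTrace_step (w : ℝ) {N : ℕ} (z : Config N) :
    ∑ c : Flips N, ringTrace w 1 (step z c) =
      2 ^ N * ringTrace w (1 - C (w ^ 2 / 4) * X ^ 2) z := by
  simp only [ringTrace_step]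
  rw [← Matrix.trace_sum, sum_prod_ofFn]
  simp only [stepMatrix_add]
  rw [prod_ofFn_smul, Matrix.trace_smul, smul_eq_mul, trace_prod_half_emptyMatrix, ringTrace]

end RingTrace

end Herman

namespace Herman

/-! ### The expected time as a sum of survival probabilities. -/

section StabilizationTime

/-- The event that no configuration with exactly one token occurs up to time `n`. -/
def survive {N : ℕ} (n : ℕ) (z : Config N) : Set (ℕ → Flips N) :=
  {ω | ∀ t ≤ n, (run z ω t).card ≠ 1}

lemma lt_stabTime_iff {N : ℕ} (z : Config N) (ω : ℕ → Flips N) (n : ℕ) :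
    (n : ℕ∞) < stabTime z ω ↔ ω ∈ survive n z := by
  constructor
  · intro h t ht hc
    have h1 : stabTime z ω ≤ t := sInf_le ⟨t, rfl, hc⟩
    have h2 : (t : ℕ∞) ≤ n := by exact_mod_cast ht
    exact absurd h (not_lt.2 (h1.trans h2))
  · intro h
    have h1 : ((n + 1 : ℕ) : ℕ∞) ≤ stabTime z ω := by
      refine le_sInf ?_
      rintro s ⟨t, rfl, hc⟩
      have : n < t := by
        by_contra! hle
        exact h t hle hc
      exact_mod_cast this
    exact lt_of_lt_of_le (by exact_mod_cast Nat.lt_succ_self n) h1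

lemma coe_eq_tsum (x : ℕ∞) : (x : ℝ≥0∞) = ∑' n : ℕ, if (n : ℕ∞) < x then 1 else 0 := by
  induction x using ENat.recTopCoe with
  | top => simp
  | coe k =>
    rw [tsum_eq_sum (s := Finset.range k)]
    · rw [Finset.sum_congr rfl (g := fun _ => (1 : ℝ≥0∞))]
      · simp
      · intro n hn
        rw [Finset.mem_range] at hn
        rw [if_pos (by exact_mod_cast hn)]
    · intro n hn
      rw [Finset.mem_range] at hn
      rw [if_neg (by exact_mod_cast hn)]

lemma run_succ' {N : ℕ} (z : Config N) (ω : ℕ → Flips N) (t : ℕ) :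
    run z ω (t + 1) = run (step z (ω 0)) (fun s => ω (s + 1)) t := by
  induction t with
  | zero => rfl
  | succ t ih => rw [run, ih]; rfl

lemma mem_survive_zero {N : ℕ} {z : Config N} {ω : ℕ → Flips N} :
    ω ∈ survive 0 z ↔ z.card ≠ 1 := by
  simp [survive, run]

lemma mem_survive_succ {N : ℕ} {n : ℕ} {z : Config N} {ω : ℕ → Flips N} :
    ω ∈ survive (n + 1) z ↔ z.card ≠ 1 ∧ (fun s => ω (s + 1)) ∈ survive n (step z (ω 0)) := by
  constructor
  · intro h
    exact ⟨h 0 (Nat.zero_le _), fun t ht => by rw [← run_succ']; exact h _ (by omega)⟩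
  · rintro ⟨h0, h⟩ t ht
    cases t with
    | zero => exact h0
    | succ t => rw [run_succ']; exact h t (by omega)

lemma measurableSet_survive {N : ℕ} (n : ℕ) (z : Config N) : MeasurableSet (survive n z) := by
  induction n generalizing z with
  | zero =>
    by_cases h : z.card = 1
    · convert MeasurableSet.empty
      ext ω
      simp [mem_survive_zero, h]
    · convert MeasurableSet.univ
      ext ω
      simp [mem_survive_zero, h]
  | succ n ih =>
    by_cases h : z.card = 1
    · convert MeasurableSet.empty
      ext ω
      simp [mem_survive_succ, h]
    · have : survive (n + 1) z = ⋃ c : Flips N, (fun ω : ℕ → Flips N => ω 0) ⁻¹' {c} ∩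
          (fun ω : ℕ → Flips N => fun s => ω (s + 1)) ⁻¹' survive n (step z c) := by
        ext ω
        simp [mem_survive_succ, h]
      rw [this]
      refine MeasurableSet.iUnion fun c => MeasurableSet.inter ?_ ?_
      · exact measurable_pi_apply 0 (measurableSet_singleton c)
      · exact (measurable_pi_lambda _ fun s => measurable_pi_apply (s + 1)) (ih _)

lemma expStabTime_eq_tsum {N : ℕ} (z : Config N) :
    expStabTime z = ∑' n, flipMeasure N (survive n z) := by
  have h : ∀ ω, (stabTime z ω : ℝ≥0∞) = ∑' n : ℕ, (survive n z).indicator 1 ω := by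
    intro ω
    rw [coe_eq_tsum]
    refine tsum_congr fun n => ?_
    by_cases hω : ω ∈ survive n z
    · rw [Set.indicator_of_mem hω, if_pos ((lt_stabTime_iff z ω n).2 hω), Pi.one_apply]
    · rw [Set.indicator_of_notMem hω, if_neg (mt (lt_stabTime_iff z ω n).1 hω)]
  rw [expStabTime]
  simp only [h]
  rw [lintegral_tsum]
  · exact tsum_congr fun n => lintegral_indicator_one (measurableSet_survive n z)
  · exact fun n => (measurable_one.indicator (measurableSet_survive n z)).aemeasurable

end StabilizationTime

/-! ### Splitting off the first step of an i.i.d. sequence. -/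

section Shift

variable {α : Type*} [MeasurableSpace α]

/-- Prepending a term to a sequence. -/
def prepend (p : α × (ℕ → α)) : ℕ → α := fun n => Nat.casesOn n p.1 p.2

lemma measurable_prepend : Measurable (prepend : α × (ℕ → α) → ℕ → α) := by
  refine measurable_pi_lambda _ fun n => ?_
  cases n with
  | zero => exact measurable_fst
  | succ n => exact (measurable_pi_apply n).comp measurable_snd

lemma map_prepend_infinitePi (ν : Measure α) [IsProbabilityMeasure ν] :
    (ν.prod (Measure.infinitePi fun _ : ℕ => ν)).map prepend =
      Measure.infinitePi fun _ : ℕ => ν := by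
  classical
  refine Measure.eq_infinitePi _ fun s t ht => ?_
  obtain ⟨n, hn⟩ : ∃ n, s ⊆ Finset.range (n + 1) :=
    ⟨s.sup id, fun i hi => Finset.mem_range_succ_iff.2 (Finset.le_sup (f := id) hi)⟩
  -- Enlarging the index set to an initial segment makes the shift of indices explicit.
  let t' : ℕ → Set α := fun i => if i ∈ s then t i else Set.univ
  have ht' : ∀ i, MeasurableSet (t' i) := fun i => by
    by_cases hi : i ∈ s
    · simpa [t', hi] using ht i
    · simp [t', hi]
  have h1 : Set.pi (s : Set ℕ) t = Set.pi (Finset.range (n + 1) : Set ℕ) t' := by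
    ext x
    simp only [Set.mem_pi, t']
    constructor
    · intro h i _
      by_cases hi : i ∈ s
      · simpa [hi] using h i hi
      · simp [hi]
    · intro h i hi
      have := h i (hn hi)
      rw [if_pos (by exact hi)] at this
      exact this
  have h2 : ∏ i ∈ s, ν (t i) = ∏ i ∈ Finset.range (n + 1), ν (t' i) := by
    rw [← Finset.prod_subset hn]
    · exact Finset.prod_congr rfl fun i hi => by simp [t', hi]
    · intro i _ hi
      simp [t', hi]
  have h3 : prepend ⁻¹' Set.pi (Finset.range (n + 1) : Set ℕ) t' =
      t' 0 ×ˢ Set.pi (Finset.range n : Set ℕ) (fun i => t' (i + 1)) := by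
    ext ⟨a, x⟩
    simp only [Set.mem_preimage, Set.mem_pi, Set.mem_prod, Finset.coe_range, Set.mem_Iio]
    constructor
    · intro h
      exact ⟨h 0 (by omega), fun i hi => h (i + 1) (by omega)⟩
    · rintro ⟨h0, h⟩ i hi
      cases i with
      | zero => exact h0
      | succ i => exact h i (by omega)
  rw [h1, h2, Measure.map_apply measurable_prepend
    (MeasurableSet.pi (Finset.countable_toSet _) fun i _ => ht' i), h3, Measure.prod_prod,
    Measure.infinitePi_pi _ (fun i _ => ht' (i + 1)), Finset.prod_range_succ', mul_comm]

end Shift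

/-! ### First-step recursion for survival, and conservation of parity. -/

section Recursion

lemma flipMeasure_survive_succ {N : ℕ} (n : ℕ) (z : Config N) (hz : z.card ≠ 1) :
    flipMeasure N (survive (n + 1) z) =
      ∑ c : Flips N, flipMeasure N (survive n (step z c)) * (2 ^ N)⁻¹ := by
  have h1 := map_prepend_infinitePi (PMF.uniformOfFintype (Flips N)).toMeasure
  have h2 : flipMeasure N (survive (n + 1) z) =
      ((PMF.uniformOfFintype (Flips N)).toMeasure.prod (flipMeasure N))
        (prepend ⁻¹' survive (n + 1) z) := by
    rw [← Measure.map_apply measurable_prepend (measurableSet_survive _ _), flipMeasure, h1]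
  have : SFinite (flipMeasure N) := by rw [flipMeasure]; infer_instance
  rw [h2, Measure.prod_apply (measurable_prepend (measurableSet_survive _ _)), lintegral_fintype]
  refine Finset.sum_congr rfl fun c _ => ?_
  congr 1
  · congr 1
    ext ω
    simp only [Set.mem_preimage, mem_survive_succ]
    simp [hz, prepend]
  · rw [PMF.toMeasure_apply_singleton _ _ (measurableSet_singleton c),
      PMF.uniformOfFintype_apply]
    simp

instance {N : ℕ} : IsProbabilityMeasure (flipMeasure N) := by
  rw [flipMeasure]; infer_instance

/-- The probability that no configuration with exactly one token occurs up to time `n`. -/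
noncomputable def survival {N : ℕ} (n : ℕ) (z : Config N) : ℝ := (flipMeasure N).real (survive n z)

lemma survival_of_card_eq_one {N : ℕ} (n : ℕ) {z : Config N} (hz : z.card = 1) :
    survival n z = 0 := by
  have : survive n z = ∅ := by
    ext ω
    simpa using fun h : ω ∈ survive n z => h 0 (Nat.zero_le _) hz
  rw [survival, this, measureReal_empty]

lemma survival_zero {N : ℕ} {z : Config N} (hz : z.card ≠ 1) : survival 0 z = 1 := by
  have : survive 0 z = Set.univ := by
    ext ω
    simp [mem_survive_zero, hz]
  rw [survival, this, probReal_univ]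

lemma survival_succ {N : ℕ} (n : ℕ) {z : Config N} (hz : z.card ≠ 1) :
    2 ^ N * survival (n + 1) z = ∑ c : Flips N, survival n (step z c) := by
  rw [survival, Measure.real, flipMeasure_survive_succ n z hz,
    ENNReal.toReal_sum (fun c _ => ENNReal.mul_ne_top (measure_ne_top _ _) (by simp)),
    Finset.mul_sum]
  refine Finset.sum_congr rfl fun c _ => ?_
  rw [ENNReal.toReal_mul, survival, Measure.real]
  simp
  field_simp

lemma survival_antitone {N : ℕ} (z : Config N) : Antitone fun n => survival n z := by
  intro m n h
  exact measureReal_mono fun ω hω t ht => hω t (ht.trans h)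

lemma odd_card_step {N : ℕ} {z : Config N} (hz : Odd z.card) (c : Flips N) :
    Odd (step z c).card := by
  have h1 : (z.filter fun i => c i = false).card + (z.filter fun i => c i = true).card =
      z.card := by
    rw [← Finset.card_filter_add_card_filter_not (s := z) (fun i => c i = false)]
    simp
  rw [step, symmDiff_def, Finset.sup_eq_union, Finset.card_union_of_disjoint disjoint_sdiff_sdiff]
  have h2 := Finset.card_sdiff_add_card_inter (z.filter fun i => c i = false)
    ((z.filter fun i => c i = true).map (finRotate N).toEmbedding)
  have h3 := Finset.card_sdiff_add_card_inter
    ((z.filter fun i => c i = true).map (finRotate N).toEmbedding) (z.filter fun i => c i = false)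
  rw [Finset.inter_comm, Finset.card_map] at h3
  grind

end Recursion

/-! ### From drift to the bound on the expected time. -/

section Lyapunov

/-- The Lyapunov function. -/
noncomputable def lyapunov {N : ℕ} (z : Config N) : ℝ :=
  4 * N ^ 2 * ((ringTrace (N : ℝ)⁻¹ 1 z).coeff 3 - 24 * (ringTrace (N : ℝ)⁻¹ 1 z).coeff 5)

lemma exists_unit_gaps {N : ℕ} {z : Config N} (hz : Odd z.card) :
    ∃ gs : List ℝ, gs.length = z.card ∧ (∀ x ∈ gs, 0 ≤ x) ∧ gs.sum = 1 ∧
      ∀ t, ringTrace (N : ℝ)⁻¹ t z = Matrix.trace (transfer t gs) := by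
  have hne : z.Nonempty := Finset.card_pos.1 hz.pos
  obtain ⟨gs, h1, h2, h3, h4⟩ := exists_gaps (inv_nonneg.2 (Nat.cast_nonneg (α := ℝ) N)) z hne
  refine ⟨gs, h1, h2, ?_, h4⟩
  rw [h3, inv_mul_cancel₀]
  have := hne.choose.pos
  exact_mod_cast this.ne'

lemma lyapunov_le {N : ℕ} {z : Config N} (hz : Odd z.card) : lyapunov z ≤ 4 / 27 * N ^ 2 := by
  obtain ⟨gs, h1, h2, h3, h4⟩ := exists_unit_gaps hz
  have := potential_le (h1 ▸ hz) h2 h3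
  rw [potential, cubicSum, quinticSum, ← h4] at this
  rw [lyapunov]
  nlinarith [sq_nonneg (N : ℝ)]

lemma lyapunov_of_card_eq_one {N : ℕ} {z : Config N} (hz : z.card = 1) : lyapunov z = 0 := by
  obtain ⟨gs, h1, -, -, h4⟩ := exists_unit_gaps (z := z) (by rw [hz]; exact odd_one)
  obtain ⟨a, rfl⟩ := List.length_eq_one_iff.1 (h1.trans hz)
  have := potential_singleton a
  rw [potential, cubicSum, quinticSum, ← h4] at this
  rw [lyapunov, this, mul_zero]

lemma sum_lyapunov_step_le {N : ℕ} {z : Config N} (hz : Odd z.card) (h1 : z.card ≠ 1) :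
    ∑ c : Flips N, lyapunov (step z c) ≤ 2 ^ N * (lyapunov z - 1) := by
  obtain ⟨gs, hlen, hnn, hs, ht⟩ := exists_unit_gaps hz
  have hN : (0 : ℝ) < N := by
    have := (Finset.card_pos.1 hz.pos).choose.pos
    exact_mod_cast this
  have h3 : 3 ≤ gs.length := by rw [hlen]; grind
  -- Edges have length `1/N`, so the weight drops by `X²/(4N²)`; the prefactor `4 N²` of `lyapunov`
  -- turns this drift into one.
  have hd := potential_drift (k := (N : ℝ)⁻¹ ^ 2 / 4) (by positivity) (hlen ▸ hz) h3 hnn hs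
  rw [potential, cubicSum, quinticSum, ← ht, ← ht] at hd
  have hsum := sum_ringTrace_step (N : ℝ)⁻¹ z
  have e : ∀ s, ∑ c : Flips N, (ringTrace (N : ℝ)⁻¹ 1 (step z c)).coeff s = 2 ^ N *
      (ringTrace (N : ℝ)⁻¹
        (1 - Polynomial.C ((N : ℝ)⁻¹ ^ 2 / 4) * Polynomial.X ^ 2) z).coeff s := by
    intro s
    rw [← Polynomial.finsetSum_coeff, hsum]
    have : (2 : Polynomial ℝ) ^ N = Polynomial.C (2 ^ N) := by rw [Polynomial.C_pow]; rfl
    rw [this, Polynomial.coeff_C_mul]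
  simp only [lyapunov]
  rw [← Finset.mul_sum, Finset.sum_sub_distrib, ← Finset.mul_sum, e, e]
  have h5 := mul_le_mul_of_nonneg_left hd (by positivity : (0 : ℝ) ≤ 2 ^ N * (4 * N ^ 2))
  have h6 : (4 * (N : ℝ) ^ 2) * ((N : ℝ)⁻¹ ^ 2 / 4) = 1 := by field_simp
  linear_combination h5 - (2 : ℝ) ^ N * h6

/-- Optional stopping by first-step induction. The Lyapunov function is not known to be nonnegative,
hence the term with `C`. -/
lemma sum_survival_le_add {N : ℕ} {C : ℝ} (hC : ∀ z : Config N, -lyapunov z ≤ C) (n : ℕ)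
    {z : Config N} (hz : Odd z.card) :
    ∑ k ∈ Finset.range n, survival k z ≤ lyapunov z + C * survival n z := by
  by_cases h1 : z.card = 1
  · simp [survival_of_card_eq_one _ h1, lyapunov_of_card_eq_one h1]
  induction n generalizing z with
  | zero =>
    rw [survival_zero h1]
    simpa using by linarith [hC z]
  | succ n ih =>
    have ih' : ∀ c : Flips N, ∑ k ∈ Finset.range n, survival k (step z c) ≤
        lyapunov (step z c) + C * survival n (step z c) := by
      intro c
      by_cases h : (step z c).card = 1
      · simp [survival_of_card_eq_one _ h, lyapunov_of_card_eq_one h]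
      · exact ih (odd_card_step hz c) h
    have h2 := Finset.sum_le_sum fun (c : Flips N) (_ : c ∈ Finset.univ) => ih' c
    rw [Finset.sum_comm, Finset.sum_add_distrib, ← Finset.mul_sum] at h2
    simp only [← survival_succ _ h1] at h2
    rw [← Finset.mul_sum] at h2
    have h3 := sum_lyapunov_step_le hz h1
    rw [Finset.sum_range_succ', survival_zero h1]
    have h4 : (0 : ℝ) < 2 ^ N := by positivity
    refine le_of_mul_le_mul_left ?_ h4
    linarith

/-- Survival is antitone with bounded partial sums, so it is `O(1/m)`, and the error term of
`sum_survival_le_add` vanishes in the limit. -/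
lemma sum_survival_le {N : ℕ} (n : ℕ) {z : Config N} (hz : Odd z.card) :
    ∑ k ∈ Finset.range n, survival k z ≤ lyapunov z := by
  obtain ⟨C, hC0, hC⟩ : ∃ C : ℝ, 0 ≤ C ∧ ∀ z : Config N, -lyapunov z ≤ C :=
    ⟨∑ z : Config N, |lyapunov z|, Finset.sum_nonneg fun _ _ => abs_nonneg _, fun z =>
      (neg_le_abs _).trans
        (Finset.single_le_sum (f := fun z : Config N => |lyapunov z|)
          (fun _ _ => abs_nonneg _) (Finset.mem_univ z))⟩
  have hnn : ∀ k, 0 ≤ survival k z := fun k => measureReal_nonneg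
  have hle1 : ∀ k, survival k z ≤ 1 := fun k => measureReal_le_one
  have hbound : ∀ m : ℕ, m * survival m z ≤ lyapunov z + C := by
    intro m
    have h1 : ∑ k ∈ Finset.range m, survival m z ≤ ∑ k ∈ Finset.range m, survival k z :=
      Finset.sum_le_sum fun k hk => survival_antitone z (Finset.mem_range.1 hk).le
    rw [Finset.sum_const, Finset.card_range, nsmul_eq_mul] at h1
    have h2 := sum_survival_le_add hC m hz
    nlinarith [hle1 m]
  have hlim : Filter.Tendsto (fun m : ℕ => lyapunov z + C * ((lyapunov z + C) / m)) Filter.atTop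
      (nhds (lyapunov z + C * 0)) :=
    ((tendsto_const_div_atTop_nhds_zero_nat _).const_mul C).const_add _
  rw [mul_zero, add_zero] at hlim
  refine ge_of_tendsto hlim (Filter.eventually_atTop.2 ⟨n + 1, fun m hm => ?_⟩)
  have hm0 : (0 : ℝ) < m := by exact_mod_cast (by omega : 0 < m)
  have h1 : ∑ k ∈ Finset.range n, survival k z ≤ ∑ k ∈ Finset.range m, survival k z :=
    Finset.sum_le_sum_of_subset_of_nonneg (Finset.range_subset_range.2 (by omega))
      fun k _ _ => hnn k
  have h2 : survival m z ≤ (lyapunov z + C) / m := by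
    rw [le_div_iff₀ hm0, mul_comm]; exact hbound m
  have h3 := mul_le_mul_of_nonneg_left h2 hC0
  linarith [sum_survival_le_add hC m hz]

theorem expStabTime_le {N : ℕ} {z : Config N} (hz : Odd z.card) :
    expStabTime z ≤ (4 / 27 : ℝ≥0) * (N : ℝ≥0∞) ^ 2 := by
  have h : ((4 / 27 : ℝ≥0) : ℝ≥0∞) * (N : ℝ≥0∞) ^ 2 = ENNReal.ofReal (4 / 27 * N ^ 2) := by
    rw [ENNReal.ofReal_mul (by norm_num), ENNReal.ofReal_pow (by positivity),
      ENNReal.ofReal_natCast]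
    congr 1
    rw [ENNReal.ofReal]
    congr 1
    rw [← NNReal.coe_inj, Real.coe_toNNReal _ (by norm_num)]
    push_cast
    rfl
  rw [h, expStabTime_eq_tsum]
  refine ENNReal.tsum_le_of_sum_range_le fun n => ?_
  have e : ∀ k, flipMeasure N (survive k z) = ENNReal.ofReal (survival k z) := fun k => by
    rw [survival, ofReal_measureReal]
  simp only [e]
  rw [← ENNReal.ofReal_sum_of_nonneg (f := fun k => survival k z) fun k _ => measureReal_nonneg]
  exact ENNReal.ofReal_le_ofReal ((sum_survival_le n hz).trans (lyapunov_le hz))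

end Lyapunov

/-! ### The extremal example. -/

section ThreeProcesses

lemma step_univ_three : ∀ c : Flips 3,
    ((c = fun _ => true) ∨ (c = fun _ => false)) ∧ step (Finset.univ : Config 3) c = Finset.univ ∨
    ¬((c = fun _ => true) ∨ (c = fun _ => false)) ∧
      (step (Finset.univ : Config 3) c).card = 1 := by
  decide

/-- Only the two constant coin patterns out of eight preserve the full ring; the other six leave one
token. -/
lemma survival_univ_three (n : ℕ) : survival n (Finset.univ : Config 3) = (1 / 4) ^ n := by
  induction n with
  | zero => rw [survival_zero (by decide), pow_zero]
  | succ n ih =>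
    have h := survival_succ n (z := (Finset.univ : Config 3)) (by decide)
    have h1 : ∀ c : Flips 3, survival n (step (Finset.univ : Config 3) c) =
        if c ∈ ({fun _ => true, fun _ => false} : Finset (Flips 3)) then (1 / 4) ^ n else 0 := by
      intro c
      rcases step_univ_three c with ⟨h1, h2⟩ | ⟨h1, h2⟩
      · rw [h2, ih, if_pos (by simpa using h1)]
      · rw [survival_of_card_eq_one _ h2, if_neg (by simpa using h1)]
    have h2 : ({fun _ => true, fun _ => false} : Finset (Flips 3)).card = 2 := by decide
    simp only [h1] at h
    rw [Finset.sum_ite_mem, Finset.univ_inter, Finset.sum_const, h2] at h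
    rw [pow_succ]
    norm_num at h ⊢
    linarith

lemma expStabTime_univ_three : expStabTime (Finset.univ : Config 3) = ENNReal.ofReal (4 / 3) := by
  have e : ∀ k, flipMeasure 3 (survive k (Finset.univ : Config 3)) =
      ENNReal.ofReal ((1 / 4) ^ k) := fun k => by
    rw [← survival_univ_three, survival, ofReal_measureReal]
  rw [expStabTime_eq_tsum]
  simp only [e]
  rw [← ENNReal.ofReal_tsum_of_nonneg (fun k => by positivity)
    (summable_geometric_of_lt_one (by norm_num) (by norm_num)),
    tsum_geometric_of_lt_one (by norm_num) (by norm_num)]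
  norm_num

end ThreeProcesses

end Herman

theorem theorem1 :
    (∀ (N : ℕ) (z : Herman.Config N), Odd z.card →
      Herman.expStabTime z ≤ (4 / 27 : ℝ≥0) * (N : ℝ≥0∞) ^ 2) ∧
    (∀ h : ℝ≥0,
      (∀ (N : ℕ) (z : Herman.Config N), 3 ≤ N → Odd z.card →
        Herman.expStabTime z ≤ h * (N : ℝ≥0∞) ^ 2) →
      4 / 27 ≤ h) := by
  refine ⟨fun N z hz => Herman.expStabTime_le hz, fun h H => ?_⟩
  have h1 := H 3 Finset.univ le_rfl (by decide)
  rw [Herman.expStabTime_univ_three] at h1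
  have h2 : (h : ℝ≥0∞) * ((3 : ℕ) : ℝ≥0∞) ^ 2 = ENNReal.ofReal (h * 9) := by
    rw [ENNReal.ofReal_mul h.coe_nonneg, ENNReal.ofReal_coe_nnreal]
    norm_num
  rw [h2, ENNReal.ofReal_le_ofReal_iff (by positivity)] at h1
  rw [← NNReal.coe_le_coe]
  push_cast
  linarith
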